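/- Let $\mathcal{A}$ be a finite set, $F_{\mathcal{A}}$ the free group on $\mathcal{A}$, $\mathcal{A}^*$ the set of finite words over $\mathcal{A}$ (including the empty word), regarded as a subset of $F_{\mathcal{A}}$, and $\mathcal{A}^+$ the set of nonempty words. A shift space is a subset $X\subseteq\mathcal{A}^{\mathbb{Z}}$ that is closed in the product topology (with $\mathcal{A}$ discrete) and invariant under the shift; it is minimal if it is nonempty and contains no nonempty shift space other than itself. Let $\mathcal{L}(X)\subseteq\mathcal{A}^*$ be the set of all finite blocks (including the empty word) occurring in elements of $X$. For $w\in\mathcal{L}(X)$, let \[ \mathcal{R}_X(w)=\{r\in\mathcal{A}^+ \mid rw\in(\mathcal{L}(X)\cap w\mathcal{A}^*)\setminus\mathcal{A}^+w\mathcal{A}^+\} \] be the set of (left) return words to $w$. The extension graph of $w$ is the bipartite graph whose vertex set is the disjoint union of $\{a\in\mathcal{A}\mid aw\in\mathcal{L}(X)\}$ and $\{b\in\mathcal{A}\mid wb\in\mathcal{L}(X)\}$, with an edge between $a$ in the first set and $b$ in the second if and only if $awb\in\mathcal{L}(X)$. The shift space $X$ is dendric if the extension graph of every $w\in\mathcal{L}(X)$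 is a tree. Let $X$ be a minimal shift space over $\mathcal{A}$ such that, for every $w\in\mathcal{L}(X)$, $\mathcal{R}_X(w)$ is a basis of the free group $F_{\mathcal{A}}$. Then $X$ is dendric. -/

import Mathlib

open SymbolicDynamics.FullShift

namespace ShiftSpace

/-- A shift space is minimal if it is nonempty and contains no nonempty shift space other than
itself. -/
def IsMinimal {A : Type*} [TopologicalSpace A] (X : Subshift A ℤ) : Prop :=
  X.carrier.Nonempty ∧
    ∀ Y : Subshift A ℤ, Y.carrier.Nonempty → Y.carrier ⊆ X.carrier → Y.carrier = X.carrier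

/-- The language of `X`: all finite words `x i, x (i+1), …, x (i+n-1)` read in points `x` of `X`.
The case `n = 0` gives the empty word. -/
def language {A : Type*} [TopologicalSpace A] (X : Subshift A ℤ) : Set (List A) :=
  {w | ∃ x ∈ X.carrier, ∃ (i : ℤ) (n : ℕ), w = List.ofFn (fun k : Fin n => x (i + (k : ℤ)))}

/-- The (left) return words to `w`: the nonempty words `r` such that `r w` is in the language,
begins with `w`, and has no occurrence of `w` that is neither a prefix nor a suffix. -/
def returnWords {A : Type*} [TopologicalSpace A] (X : Subshift A ℤ) (w : List A) :
    Set (List A) :=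
  {r | r ≠ [] ∧ r ++ w ∈ language X ∧ (∃ t, r ++ w = w ++ t) ∧
    ¬ ∃ p s : List A, p ≠ [] ∧ s ≠ [] ∧ r ++ w = p ++ w ++ s}

/-- The canonical embedding of words into the free group. -/
def toFreeGroup {A : Type*} (w : List A) : FreeGroup A :=
  (w.map FreeGroup.of).prod

/-- A subset `S` of a group `G` is a basis of `G` if `G` is free on `S`. -/
def IsBasis {G : Type*} [Group G] (S : Set G) : Prop :=
  ∃ b : FreeGroupBasis S G, ∀ s : S, b s = (s : G)

/-- Letters `a` such that `a w` is in the language. -/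
def leftExt {A : Type*} [TopologicalSpace A] (X : Subshift A ℤ) (w : List A) : Set A :=
  {a | a :: w ∈ language X}

/-- Letters `b` such that `w b` is in the language. -/
def rightExt {A : Type*} [TopologicalSpace A] (X : Subshift A ℤ) (w : List A) : Set A :=
  {b | w ++ [b] ∈ language X}

/-- Pairs of letters `(a, b)` such that `a w b` is in the language. -/
def biExt {A : Type*} [TopologicalSpace A] (X : Subshift A ℤ) (w : List A) : Set (A × A) :=
  {p | p.1 :: (w ++ [p.2]) ∈ language X}

/-- The extension graph of `w`: the bipartite graph on the disjoint union of the left and the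
right extensions, with an edge between `a` on the left and `b` on the right when `a w b` is in
the language. -/
def extensionGraph {A : Type*} [TopologicalSpace A] (X : Subshift A ℤ) (w : List A) :
    SimpleGraph (leftExt X w ⊕ rightExt X w) where
  Adj u v :=
    (∃ (a : leftExt X w) (b : rightExt X w),
      u = Sum.inl a ∧ v = Sum.inr b ∧ ((a : A), (b : A)) ∈ biExt X w) ∨
    (∃ (a : leftExt X w) (b : rightExt X w),
      v = Sum.inl a ∧ u = Sum.inr b ∧ ((a : A), (b : A)) ∈ biExt X w)
  symm := ⟨fun _ _ h => h.symm⟩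
  loopless := ⟨by
    rintro u (⟨a, b, h, h', -⟩ | ⟨a, b, h, h', -⟩) <;> · rw [h] at h'; cases h'⟩

/-- A shift space is dendric if the extension graph of each word of its language is a tree. -/
def IsDendric {A : Type*} [TopologicalSpace A] (X : Subshift A ℤ) : Prop :=
  ∀ w ∈ language X, (extensionGraph X w).IsTree

end ShiftSpace

/-! Fix a point `x` of `X` and a long word `w` whose occurrences are far apart. Take a segment
labelled by the first `g` letters of `w` and join its end to its origin by one path for each return
word to `w`. The point `x` walks in this labelled graph; the graph has rank `|A|`, and the extension
graphs of its paths shorter than the segment are stars, hence trees.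

Consider the states of the walk at the occurrences of a word. If every return word to it carried
equal states to equal states and distinct ones to distinct ones, then the free group would act on
the states through the basis of return words; as the return words to longer words generate the whole
group, all states would be fixed, hence equal. So, while the walk visits several vertices, two edges
with the same label leave a common vertex after arbitrarily long common paths, possibly after time
is reversed, and they can be folded as in Stallings' algorithm. A fold never increases the rank.
Since `x` reads all the letters, the graph with one vertex reached in the end still has rank at
least `|A|`, so every fold preserves the rank. Such a fold keeps the extension graphs trees: it
either identifies two neighbours of a common vertex in a tree or glues two trees along one vertex.
In the graph with one vertex, paths are words and their extension graphs are those of `X`.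

If no such `w` exists then `x` is periodic, which forces `|A| = 1`.
-/

namespace ShiftSpace

section NCard

variable {α β : Type*} {S : Set α} {h : α → β} {e e' : α}

theorem image_sdiff_singleton_of_eq (he : e ∈ S) (hne : e ≠ e') (h_eq : h e = h e') :
    h '' (S \ {e'}) = h '' S := by
  refine Set.Subset.antisymm (Set.image_mono Set.sdiff_subset) ?_
  rintro _ ⟨p, hp, rfl⟩
  by_cases hpe : p = e'
  · exact ⟨e, ⟨he, hne⟩, by rw [h_eq, hpe]⟩
  · exact ⟨p, ⟨hp, hpe⟩, rfl⟩

theorem ncard_image_add_one_le_of_eq (hS : S.Finite) (he : e ∈ S) (he' : e' ∈ S) (hne : e ≠ e')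
    (h_eq : h e = h e') : (h '' S).ncard + 1 ≤ S.ncard := by
  rw [← image_sdiff_singleton_of_eq he hne h_eq, ← Set.ncard_sdiff_singleton_add_one he' hS]
  exact Nat.add_le_add_right (Set.ncard_image_le hS.sdiff) 1

theorem ncard_le_ncard_image_add_one (hS : S.Finite) (hinj : Set.InjOn h (S \ {e'})) :
    S.ncard ≤ (h '' S).ncard + 1 := by
  have h_card : S.ncard ≤ (S \ {e'}).ncard + 1 := by
    simpa using Set.ncard_le_ncard_sdiff_add_ncard S {e'}
  rw [← hinj.ncard_image] at h_card
  exact h_card.trans (Nat.add_le_add_right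
    (Set.ncard_le_ncard (Set.image_mono Set.sdiff_subset) (hS.image h)) 1)

theorem eq_or_of_ncard_le_ncard_image_add_one (hS : S.Finite) (he : e ∈ S) (he' : e' ∈ S)
    (hne : e ≠ e') (h_eq : h e = h e') (hcard : S.ncard ≤ (h '' S).ncard + 1) {u v : α}
    (hu : u ∈ S) (hv : v ∈ S) (huv : h u = h v) :
    u = v ∨ (u = e ∧ v = e') ∨ (u = e' ∧ v = e) := by
  have hinj : Set.InjOn h (S \ {e'}) := by
    refine Set.injOn_of_ncard_image_eq (le_antisymm (Set.ncard_image_le hS.sdiff) ?_) hS.sdiff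
    rw [image_sdiff_singleton_of_eq he hne h_eq]
    have := Set.ncard_sdiff_singleton_add_one he' hS
    omega
  by_cases hue : u = e' <;> by_cases hve : v = e'
  · exact .inl (hue.trans hve.symm)
  · exact .inr (.inr ⟨hue, hinj ⟨hv, hve⟩ ⟨he, hne⟩ (by rw [h_eq, ← hue, huv])⟩)
  · exact .inr (.inl ⟨hinj ⟨hu, hue⟩ ⟨he, hne⟩ (by rw [h_eq, ← hve, huv]), hve⟩)
  · exact .inl (hinj ⟨hu, hue⟩ ⟨hv, hve⟩ huv)

end NCard

section BipartiteRelations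

variable {α β α' β' : Type*} {B B₁ B₂ : Set (α × β)} {L : Set α} {R : Set β}

/-- One step between edges of a bipartite graph that share an endpoint; `B` is the set of edges,
as pairs of a left and a right vertex. -/
def EdgeAdj (B : Set (α × β)) (u v : α × β) : Prop :=
  v ∈ B ∧ (u.1 = v.1 ∨ u.2 = v.2)

/-- Connectedness of the bipartite graph with edge set `B` and no isolated vertex, in terms of
chains of edges. -/
def EdgeConnected (B : Set (α × β)) : Prop :=
  ∀ u ∈ B, ∀ v ∈ B, Relation.ReflTransGen (EdgeAdj B) u v

/-- The bipartite graph with edge set `B`, whose vertices are the two projections of `B`, is a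
finite tree. The inequality opposite to `card_le` follows from connectedness. -/
structure IsTreeRel (B : Set (α × β)) : Prop where
  finite : B.Finite
  nonempty : B.Nonempty
  connected : EdgeConnected B
  card_le : B.ncard + 1 ≤ (Prod.fst '' B).ncard + (Prod.snd '' B).ncard

/-- The bipartite graph on `L ⊕ R` with edge relation `B`. The adjacency relation is spelled as
in `extensionGraph`, which is an instance of it by definition. -/
def bipartiteGraph (L : Set α) (R : Set β) (B : Set (α × β)) : SimpleGraph (L ⊕ R) where
  Adj u v :=
    (∃ (a : L) (b : R), u = Sum.inl a ∧ v = Sum.inr b ∧ ((a : α), (b : β)) ∈ B) ∨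
    (∃ (a : L) (b : R), v = Sum.inl a ∧ u = Sum.inr b ∧ ((a : α), (b : β)) ∈ B)
  symm := ⟨fun _ _ h => h.symm⟩
  loopless := ⟨by
    rintro u (⟨a, b, h, h', -⟩ | ⟨a, b, h, h', -⟩) <;> · rw [h] at h'; cases h'⟩

theorem bipartiteGraph_connected (hL : Prod.fst '' B = L) (hR : Prod.snd '' B = R)
    (hne : B.Nonempty) (hB : EdgeConnected B) : (bipartiteGraph L R B).Connected := by
  subst hL hR
  set G := bipartiteGraph (Prod.fst '' B) (Prod.snd '' B) B
  let left (p : B) : Prod.fst '' B ⊕ Prod.snd '' B := .inl ⟨p.1.1, p, p.2, rfl⟩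
  let right (p : B) : Prod.fst '' B ⊕ Prod.snd '' B := .inr ⟨p.1.2, p, p.2, rfl⟩
  have hadj (p : B) : G.Reachable (left p) (right p) :=
    SimpleGraph.Adj.reachable (.inl ⟨_, _, rfl, rfl, p.2⟩)
  have hstep (p q : B) (h : EdgeAdj B p q) : G.Reachable (left p) (left q) := by
    obtain ⟨-, h | h⟩ := h
    · rw [show left p = left q from congrArg Sum.inl (Subtype.ext h)]
    · refine (hadj p).trans ?_
      rw [show right p = right q from congrArg Sum.inr (Subtype.ext h)]
      exact (hadj q).symm
  obtain ⟨p₀, hp₀⟩ := hne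
  have hleft : ∀ q (hq : q ∈ B), G.Reachable (left ⟨p₀, hp₀⟩) (left ⟨q, hq⟩) := by
    intro q hq
    induction hB p₀ hp₀ q hq with
    | refl => rfl
    | @tail u v huu huv ih =>
      have hu : u ∈ B := by
        rcases huu.cases_tail with rfl | ⟨_, -, hu⟩
        exacts [hp₀, hu.1]
      exact (ih hu).trans (hstep ⟨u, hu⟩ ⟨v, hq⟩ huv)
  have hreach : ∀ z, G.Reachable (left ⟨p₀, hp₀⟩) z := by
    rintro (⟨_, q, hq, rfl⟩ | ⟨_, q, hq, rfl⟩)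
    · exact hleft q hq
    · exact (hleft q hq).trans (hadj ⟨q, hq⟩)
  exact SimpleGraph.connected_iff_exists_forall_reachable G |>.2 ⟨_, hreach⟩

theorem card_edgeSet_bipartiteGraph (hL : Prod.fst '' B = L) (hR : Prod.snd '' B = R) :
    Nat.card (bipartiteGraph L R B).edgeSet = B.ncard := by
  subst hL hR
  set G := bipartiteGraph (Prod.fst '' B) (Prod.snd '' B) B
  let edge (p : B) : G.edgeSet :=
    ⟨s(.inl ⟨p.1.1, p, p.2, rfl⟩, .inr ⟨p.1.2, p, p.2, rfl⟩), .inl ⟨_, _, rfl, rfl, p.2⟩⟩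
  have h_edge : Function.Bijective edge := by
    refine ⟨fun p q h => Subtype.ext ?_, ?_⟩
    · simpa [edge, Subtype.ext_iff, Prod.ext_iff] using h
    · rintro ⟨z, hz⟩
      induction z with | _ u v
      obtain ⟨a, b, rfl, rfl, h⟩ | ⟨a, b, rfl, rfl, h⟩ := G.mem_edgeSet.1 hz
      · exact ⟨⟨_, h⟩, rfl⟩
      · exact ⟨⟨_, h⟩, Subtype.ext Sym2.eq_swap⟩
  exact (Nat.card_congr (Equiv.ofBijective edge h_edge)).symm.trans (Nat.card_coe_set_eq B)

theorem card_sum_coe (hL : L.Finite) (hR : R.Finite) : Nat.card (L ⊕ R) = L.ncard + R.ncard := by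
  have := hL.to_subtype
  have := hR.to_subtype
  rw [Nat.card_sum, Nat.card_coe_set_eq, Nat.card_coe_set_eq]

theorem EdgeConnected.ncard_add_ncard_le (hfin : B.Finite) (hne : B.Nonempty)
    (hB : EdgeConnected B) :
    (Prod.fst '' B).ncard + (Prod.snd '' B).ncard ≤ B.ncard + 1 := by
  have h := (bipartiteGraph_connected rfl rfl hne hB).card_vert_le_card_edgeSet_add_one
  rwa [card_edgeSet_bipartiteGraph rfl rfl, card_sum_coe (hfin.image _) (hfin.image _)] at h

theorem IsTreeRel.isTree (hB : IsTreeRel B) (hL : Prod.fst '' B = L) (hR : Prod.snd '' B = R) :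
    (bipartiteGraph L R B).IsTree := by
  have hL_fin : L.Finite := hL ▸ hB.finite.image _
  have hR_fin : R.Finite := hR ▸ hB.finite.image _
  have := hL_fin.to_subtype
  have := hR_fin.to_subtype
  rw [SimpleGraph.isTree_iff_connected_and_card, card_edgeSet_bipartiteGraph hL hR,
    card_sum_coe hL_fin hR_fin, ← hL, ← hR]
  exact ⟨bipartiteGraph_connected rfl rfl hB.nonempty hB.connected,
    hB.card_le.antisymm (hB.connected.ncard_add_ncard_le hB.finite hB.nonempty)⟩

theorem fst_image_prodMap (B : Set (α × β)) (g : α → α') (h : β → β') :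
    Prod.fst '' (Prod.map g h '' B) = g '' (Prod.fst '' B) := by
  simp [Set.image_image]

theorem snd_image_prodMap (B : Set (α × β)) (g : α → α') (h : β → β') :
    Prod.snd '' (Prod.map g h '' B) = h '' (Prod.snd '' B) := by
  simp [Set.image_image]

theorem EdgeConnected.prodMap_image (hB : EdgeConnected B) (g : α → α') (h : β → β') :
    EdgeConnected (Prod.map g h '' B) := by
  rintro _ ⟨u, hu, rfl⟩ _ ⟨v, hv, rfl⟩
  refine Relation.ReflTransGen.lift (Prod.map g h) ?_ _ _ (hB u hu v hv)
  rintro a b ⟨hb, hab⟩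
  exact ⟨⟨b, hb, rfl⟩, hab.imp (congrArg g) (congrArg h)⟩

theorem EdgeConnected.swap_image (hB : EdgeConnected B) : EdgeConnected (Prod.swap '' B) := by
  rintro _ ⟨u, hu, rfl⟩ _ ⟨v, hv, rfl⟩
  refine Relation.ReflTransGen.lift Prod.swap ?_ _ _ (hB u hu v hv)
  rintro a b ⟨hb, hab⟩
  exact ⟨⟨b, hb, rfl⟩, hab.symm⟩

namespace IsTreeRel

theorem swap_image (hB : IsTreeRel B) : IsTreeRel (Prod.swap '' B) where
  finite := hB.finite.image _
  nonempty := hB.nonempty.image _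
  connected := hB.connected.swap_image
  card_le := by
    rw [Set.ncard_image_of_injective _ Prod.swap_injective, Set.image_image, Set.image_image]
    exact hB.card_le.trans_eq (add_comm _ _)

theorem of_fst_eq (hfin : B.Finite) (hne : B.Nonempty) (h : ∀ u ∈ B, ∀ v ∈ B, u.1 = v.1) :
    IsTreeRel B where
  finite := hfin
  nonempty := hne
  connected u hu v hv := .single ⟨hv, .inl (h u hu v hv)⟩
  card_le := by
    have h_snd : (Prod.snd '' B).ncard = B.ncard := Set.InjOn.ncard_image
      fun u hu v hv huv => Prod.ext (h u hu v hv) huv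
    have h_fst := (Set.ncard_pos (hfin.image Prod.fst)).2 (hne.image _)
    omega

theorem of_snd_eq (hfin : B.Finite) (hne : B.Nonempty) (h : ∀ u ∈ B, ∀ v ∈ B, u.2 = v.2) :
    IsTreeRel B := by
  have h_swap : IsTreeRel (Prod.swap '' B) :=
    of_fst_eq (hfin.image _) (hne.image _) (by
      rintro _ ⟨u, hu, rfl⟩ _ ⟨v, hv, rfl⟩
      exact h u hu v hv)
  simpa [Set.image_image] using h_swap.swap_image

theorem prodMap_image (hB : IsTreeRel B) {g : α → α'} {h : β → β'}
    (hg : Set.InjOn g (Prod.fst '' B)) (hh : Set.InjOn h (Prod.snd '' B)) :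
    IsTreeRel (Prod.map g h '' B) where
  finite := hB.finite.image _
  nonempty := hB.nonempty.image _
  connected := hB.connected.prodMap_image g h
  card_le := by
    rw [fst_image_prodMap, snd_image_prodMap, hg.ncard_image, hh.ncard_image]
    exact (Nat.add_le_add_right (Set.ncard_image_le hB.finite) 1).trans hB.card_le

theorem prodMap_image_of_common_neighbor (hB : IsTreeRel B) {g : α → α'} {h : β → β'}
    (hg : Set.InjOn g (Prod.fst '' B)) {e e' : β} {c : α} (hne : e ≠ e') (he : (c, e) ∈ B)
    (he' : (c, e') ∈ B) (h_eq : h e = h e') (hh : Set.InjOn h (Prod.snd '' B \ {e'})) :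
    IsTreeRel (Prod.map g h '' B) where
  finite := hB.finite.image _
  nonempty := hB.nonempty.image _
  connected := hB.connected.prodMap_image g h
  card_le := by
    rw [fst_image_prodMap, snd_image_prodMap, hg.ncard_image]
    have h_edges : (Prod.map g h '' B).ncard + 1 ≤ B.ncard :=
      ncard_image_add_one_le_of_eq hB.finite he he' (by simpa using hne) (by simp [h_eq])
    have h_right := ncard_le_ncard_image_add_one (hB.finite.image Prod.snd) hh
    have := hB.card_le
    omega

theorem common_neighbor_unique (hB : IsTreeRel B) {e e' : β} {c c' : α} (hne : e ≠ e')
    (hce : (c, e) ∈ B) (hce' : (c, e') ∈ B) (hc'e : (c', e) ∈ B) (hc'e' : (c', e') ∈ B) :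
    c = c' := by
  classical
  -- After identifying `e'` with `e`, a second common neighbour would leave too few edges for the
  -- quotient to be connected.
  let h := Function.update id e' e
  have h_eq : h e = h e' := by simp [h, hne]
  have h_inj : Set.InjOn h (Prod.snd '' B \ {e'}) := fun a ha b hb hab => by
    simpa [h, Function.update_of_ne ha.2, Function.update_of_ne hb.2] using hab
  have h_conn := (hB.connected.prodMap_image id h).ncard_add_ncard_le (hB.finite.image _)
    (hB.nonempty.image _)
  rw [fst_image_prodMap, snd_image_prodMap, Set.image_id] at h_conn
  have h_right := ncard_le_ncard_image_add_one (hB.finite.image Prod.snd) h_inj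
  have h_card := hB.card_le
  have h_cases := eq_or_of_ncard_le_ncard_image_add_one (h := Prod.map id h) hB.finite hce hce'
    (by simpa using hne) (by simp [h_eq]) (by omega) hc'e hc'e' (by simp [h_eq])
  simp only [Prod.mk.injEq] at h_cases
  grind

theorem union (hB₁ : IsTreeRel B₁) (hB₂ : IsTreeRel B₂) {c : α}
    (hL : Prod.fst '' B₁ ∩ Prod.fst '' B₂ = {c})
    (hR : Disjoint (Prod.snd '' B₁) (Prod.snd '' B₂)) : IsTreeRel (B₁ ∪ B₂) where
  finite := hB₁.finite.union hB₂.finite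
  nonempty := hB₁.nonempty.inl
  connected := by
    obtain ⟨⟨p, hp, rfl⟩, ⟨q, hq, hqp⟩⟩ := hL.symm ▸ Set.mem_singleton c
    have h₁ : ∀ u ∈ B₁, ∀ v ∈ B₁, Relation.ReflTransGen (EdgeAdj (B₁ ∪ B₂)) u v :=
      fun u hu v hv => Relation.ReflTransGen.mono (fun _ _ h => ⟨.inl h.1, h.2⟩) _ _
        (hB₁.connected u hu v hv)
    have h₂ : ∀ u ∈ B₂, ∀ v ∈ B₂, Relation.ReflTransGen (EdgeAdj (B₁ ∪ B₂)) u v :=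
      fun u hu v hv => Relation.ReflTransGen.mono (fun _ _ h => ⟨.inr h.1, h.2⟩) _ _
        (hB₂.connected u hu v hv)
    rintro u (hu | hu) v (hv | hv)
    · exact h₁ u hu v hv
    · exact ((h₁ u hu p hp).tail ⟨.inr hq, .inl hqp.symm⟩).trans (h₂ q hq v hv)
    · exact ((h₂ u hu q hq).tail ⟨.inl hp, .inl hqp⟩).trans (h₁ p hp v hv)
    · exact h₂ u hu v hv
  card_le := by
    rw [Set.image_union, Set.image_union,
      Set.ncard_union_eq hR (hB₁.finite.image _) (hB₂.finite.image _)]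
    have h_left := Set.ncard_union_add_ncard_inter (Prod.fst '' B₁) (Prod.fst '' B₂)
      (hB₁.finite.image _) (hB₂.finite.image _)
    rw [hL, Set.ncard_singleton] at h_left
    have := Set.ncard_union_le B₁ B₂
    have := hB₁.card_le
    have := hB₂.card_le
    omega

end IsTreeRel

end BipartiteRelations

section FreeBases

variable {A G H : Type*} [Group G] [Group H]

theorem IsBasis.exists_hom {S : Set G} (hS : IsBasis S) (u : S → H) :
    ∃ φ : G →* H, ∀ s : S, φ s = u s := by
  obtain ⟨b, hb⟩ := hS
  refine ⟨b.lift u, fun s => ?_⟩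
  rw [← hb s]
  exact congrFun (b.lift.symm_apply_apply u) s

theorem IsBasis.closure_eq_top {S : Set G} (hS : IsBasis S) : Subgroup.closure S = ⊤ := by
  obtain ⟨b, hb⟩ := hS
  have hS_eq : S = (b.repr.symm : FreeGroup S →* G) '' Set.range FreeGroup.of := by
    rw [← Set.range_comp]
    exact (Subtype.range_coe (s := S)).symm.trans (congrArg Set.range (funext fun s => (hb s).symm))
  rw [hS_eq, ← MonoidHom.map_closure, FreeGroup.closure_range_of]
  exact Subgroup.map_top_of_surjective _ b.repr.symm.surjective

theorem IsBasis.card_eq {S : Set (FreeGroup A)} (hS : IsBasis S) : Nat.card S = Nat.card A := by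
  obtain ⟨b, -⟩ := hS
  exact (Nat.card_congr (Equiv.ofFreeGroupEquiv b.repr)).symm

theorem toFreeGroup_append (v w : List A) :
    toFreeGroup (v ++ w) = toFreeGroup v * toFreeGroup w := by
  simp [toFreeGroup]

theorem toFreeGroup_eq_mk (w : List A) :
    toFreeGroup w = FreeGroup.mk (w.map fun a => (a, true)) := by
  induction w with
  | nil => rfl
  | cons a w ih =>
    rw [← List.singleton_append, toFreeGroup_append, ih]
    simp [toFreeGroup, FreeGroup.of]

theorem toFreeGroup_injective : Function.Injective (toFreeGroup : List A → FreeGroup A) := by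
  classical
  have toWord_eq (w : List A) : (toFreeGroup w).toWord = w.map fun a => (a, true) := by
    rw [toFreeGroup_eq_mk, FreeGroup.toWord_mk]
    refine FreeGroup.IsReduced.reduce_eq ((List.isChain_map _).2 ?_)
    exact (List.pairwise_of_forall (by simp)).isChain
  refine Function.Injective.of_comp (f := FreeGroup.toWord) ?_
  rw [show FreeGroup.toWord ∘ toFreeGroup = List.map (fun a : A => (a, true)) from
    funext toWord_eq]
  exact List.map_injective_iff.2 (Prod.mk_left_injective true)

end FreeBases

theorem exists_perm_of_eq_iff {I M : Type*} [Finite M] (a b : I → M)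
    (h : ∀ i j, a i = a j ↔ b i = b j) : ∃ σ : Equiv.Perm M, ∀ i, σ (a i) = b i := by
  classical
  have := Fintype.ofFinite M
  let e : Set.range a ≃ Set.range b :=
    (Setoid.quotientKerEquivRange a).symm.trans
      ((Quotient.congrRight h).trans (Setoid.quotientKerEquivRange b))
  have he (i : I) : e ⟨a i, i, rfl⟩ = ⟨b i, i, rfl⟩ := by
    have : (Setoid.quotientKerEquivRange a).symm ⟨a i, i, rfl⟩ = Quotient.mk _ i := by
      rw [Equiv.symm_apply_eq]; rfl
    simp only [e, Equiv.trans_apply, this]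
    rfl
  refine ⟨e.extendSubtype, fun i => ?_⟩
  rw [e.extendSubtype_apply_of_mem _ ⟨i, rfl⟩, he]

section Words

variable {A : Type*} {x y : ℤ → A} {s t : ℤ} {d : ℕ} {w : List A}

/-- The word `x s, …, x (s + d - 1)`. -/
def wordAt (x : ℤ → A) (s : ℤ) (d : ℕ) : List A :=
  List.ofFn fun k : Fin d => x (s + (k : ℤ))

/-- The word `w` occurs in `x` at position `s`. -/
def Occ (x : ℤ → A) (w : List A) (s : ℤ) : Prop :=
  wordAt x s w.length = w

/-- The positions `s` and `s + d` are consecutive occurrences of `w` in `x`. -/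
structure IsReturn (x : ℤ → A) (w : List A) (s : ℤ) (d : ℕ) : Prop where
  pos : 0 < d
  occ : Occ x w s
  occ_add : Occ x w (s + d)
  not_occ : ∀ k : ℤ, 0 < k → k < d → ¬ Occ x w (s + k)

/-- The return words to `w` that are read in the point `x`. -/
def returnSet (x : ℤ → A) (w : List A) : Set (List A) :=
  {r | ∃ s d, IsReturn x w s d ∧ wordAt x s d = r}

/-- All return sets of the point `x` are bases of the free group. -/
def HasBasicReturns (x : ℤ → A) : Prop :=
  ∀ w, (∃ s, Occ x w s) → IsBasis (toFreeGroup '' returnSet x w)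

/-- `f i` depends only on a window of bounded length around the position `i` of `x`. -/
def IsLocal {V : Type*} (x : ℤ → A) (f : ℤ → V) : Prop :=
  ∃ N : ℕ, ∀ i j, (∀ k : ℤ, -N ≤ k → k ≤ N → x (i + k) = x (j + k)) → f i = f j

@[simp]
theorem length_wordAt (x : ℤ → A) (s : ℤ) (d : ℕ) : (wordAt x s d).length = d := by
  simp [wordAt]

theorem wordAt_eq_iff :
    wordAt x s d = wordAt y t d ↔ ∀ k : ℤ, 0 ≤ k → k < d → x (s + k) = y (t + k) := by
  rw [wordAt, wordAt, List.ofFn_inj, funext_iff]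
  refine ⟨fun h k hk hkd => ?_, fun h k => h k (by omega) (by omega)⟩
  lift k to ℕ using hk
  exact h ⟨k, by omega⟩

theorem wordAt_add (x : ℤ → A) (s : ℤ) (d e : ℕ) :
    wordAt x s (d + e) = wordAt x s d ++ wordAt x (s + d) e := by
  rw [wordAt, List.ofFn_add]
  simp [wordAt, add_assoc]

theorem occ_wordAt (x : ℤ → A) (s : ℤ) (d : ℕ) : Occ x (wordAt x s d) s := by
  rw [Occ, length_wordAt]

theorem occ_wordAt_iff :
    Occ x (wordAt y s d) t ↔ ∀ k : ℤ, 0 ≤ k → k < d → x (t + k) = y (s + k) := by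
  rw [Occ, length_wordAt, wordAt_eq_iff]

theorem occ_append_iff {v : List A} : Occ x (v ++ w) s ↔ Occ x v s ∧ Occ x w (s + v.length) := by
  rw [Occ, List.length_append, wordAt_add,
    List.append_eq_append_iff_of_size_eq_left (length_wordAt x s _), Occ, Occ]

theorem occ_singleton_iff {a : A} : Occ x [a] s ↔ x s = a := by
  simp [Occ, wordAt]

theorem occ_cons_iff {a : A} : Occ x (a :: w) s ↔ x s = a ∧ Occ x w (s + 1) := by
  rw [← List.singleton_append, occ_append_iff, occ_singleton_iff]
  rfl

theorem occ_append_singleton_iff {b : A} :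
    Occ x (w ++ [b]) s ↔ Occ x w s ∧ x (s + w.length) = b := by
  rw [occ_append_iff, occ_singleton_iff]

theorem occ_add_iff_exists_append {v : List A} {k : ℕ} (hv : Occ x v s)
    (hk : k + w.length ≤ v.length) :
    Occ x w (s + k) ↔ ∃ p u, p.length = k ∧ v = p ++ w ++ u := by
  constructor
  · intro hw
    obtain ⟨n, hn⟩ := Nat.exists_eq_add_of_le hk
    refine ⟨wordAt x s k, wordAt x (s + (k + w.length : ℕ)) n, length_wordAt x s k, ?_⟩
    rw [← hv, hn, wordAt_add, wordAt_add, hw]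
  · rintro ⟨p, u, rfl, rfl⟩
    exact (occ_append_iff.1 (occ_append_iff.1 hv).1).2

theorem isReturn_length_iff {r : List A} (hr : Occ x (r ++ w) s) :
    IsReturn x w s r.length ↔ r ≠ [] ∧ (∃ t, r ++ w = w ++ t) ∧
      ¬ ∃ p u : List A, p ≠ [] ∧ u ≠ [] ∧ r ++ w = p ++ w ++ u := by
  have h_prefix : (∃ t, r ++ w = w ++ t) ↔ Occ x w s := by
    simpa [eq_comm] using (occ_add_iff_exists_append (w := w) (k := 0) hr (by simp)).symm
  rw [h_prefix]
  constructor
  · refine fun h => ⟨List.length_pos_iff.1 h.pos, h.occ, ?_⟩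
    rintro ⟨p, u, hp, hu, h_eq⟩
    have h_length := congrArg List.length h_eq
    have hp_pos := List.length_pos_iff.2 hp
    have hu_pos := List.length_pos_iff.2 hu
    simp only [List.length_append] at h_length
    exact h.not_occ p.length (by omega) (by omega)
      ((occ_add_iff_exists_append hr (by simp; omega)).2 ⟨p, u, rfl, h_eq⟩)
  · rintro ⟨h_ne, h_occ, h_inner⟩
    refine ⟨List.length_pos_iff.2 h_ne, h_occ, (occ_append_iff.1 hr).2, fun k hk hkr hk_occ => ?_⟩
    lift k to ℕ using hk.le
    obtain ⟨p, u, rfl, h_eq⟩ := (occ_add_iff_exists_append hr (by simp; omega)).1 hk_occ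
    have h_length := congrArg List.length h_eq
    simp only [List.length_append] at h_length
    exact h_inner ⟨p, u, List.length_pos_iff.1 (by omega), List.length_pos_iff.1 (by omega), h_eq⟩

theorem occ_shift_iff {g : ℤ} : Occ (shift g x) w s ↔ Occ x w (g + s) := by
  simp [Occ, wordAt, add_assoc]

theorem exists_isReturn (hs : Occ x w s) (hd : 0 < d) (hsd : Occ x w (s + d)) :
    ∃ e, IsReturn x w s e ∧ e ≤ d := by
  classical
  have h_ex : ∃ k : ℕ, 0 < k ∧ Occ x w (s + k) := ⟨d, hd, hsd⟩
  refine ⟨Nat.find h_ex, ⟨(Nat.find_spec h_ex).1, hs, (Nat.find_spec h_ex).2, ?_⟩,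
    Nat.find_min' h_ex ⟨hd, hsd⟩⟩
  intro k hk hk_lt hk_occ
  lift k to ℕ using hk.le
  exact Nat.find_min h_ex (by omega) ⟨by omega, hk_occ⟩

theorem Occ.induction {P : ℤ → ℕ → Prop} (zero : ∀ s, P s 0)
    (add : ∀ s d e, IsReturn x w s d → P (s + d) e → P s (d + e)) (hs : Occ x w s)
    (hsd : Occ x w (s + d)) : P s d := by
  induction d using Nat.strong_induction_on generalizing s with
  | _ d ih =>
    rcases Nat.eq_zero_or_pos d with rfl | hd
    · exact zero s
    obtain ⟨e, he, hed⟩ := exists_isReturn hs hd hsd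
    obtain ⟨k, rfl⟩ := Nat.exists_eq_add_of_le hed
    refine add s e k he (ih k (by have := he.pos; omega) he.occ_add ?_)
    rwa [Nat.cast_add, ← add_assoc] at hsd

end Words

section Monodromy

variable {A M : Type*} {x : ℤ → A} {w : List A} {m : ℤ → M}

theorem exists_hom_of_isReturn [Finite M] (hw : IsBasis (toFreeGroup '' returnSet x w))
    (h_iff : ∀ s s' d, IsReturn x w s d → IsReturn x w s' d → wordAt x s d = wordAt x s' d →
      (m (s + d) = m (s' + d) ↔ m s = m s')) :
    ∃ φ : FreeGroup A →* Equiv.Perm M, ∀ s (d : ℕ), Occ x w s → Occ x w (s + d) →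
      φ (toFreeGroup (wordAt x s d)) (m (s + d)) = m s := by
  have h_perm (g : toFreeGroup '' returnSet x w) : ∃ σ : Equiv.Perm M, ∀ s d, IsReturn x w s d →
      toFreeGroup (wordAt x s d) = g → σ (m (s + d)) = m s := by
    obtain ⟨_, r, -, rfl⟩ := g
    obtain ⟨σ, hσ⟩ := exists_perm_of_eq_iff
      (fun s : {s // IsReturn x w s r.length ∧ wordAt x s r.length = r} => m (s + r.length))
      (fun s => m s) fun s s' => h_iff s s' _ s.2.1 s'.2.1 (s.2.2.trans s'.2.2.symm)
    refine ⟨σ, fun s d hs h_eq => ?_⟩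
    obtain rfl := toFreeGroup_injective h_eq
    simpa using hσ ⟨s, by simpa using hs⟩
  choose σ hσ using h_perm
  obtain ⟨φ, hφ⟩ := hw.exists_hom σ
  refine ⟨φ, fun s d hs hsd => hs.induction
    (P := fun s d => φ (toFreeGroup (wordAt x s d)) (m (s + d)) = m s) ?_ ?_ hsd⟩
  · simp [wordAt, toFreeGroup]
  · intro s d e hsd ih
    rw [wordAt_add, toFreeGroup_append, map_mul, Equiv.Perm.mul_apply, Nat.cast_add,
      ← add_assoc, ih]
    exact (congrFun (congrArg _ (hφ ⟨_, _, ⟨s, d, hsd, rfl⟩, rfl⟩)) _).trans (hσ _ s d hsd rfl)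

theorem toFreeGroup_wordAt_mul (x : ℤ → A) (s : ℤ) (d e : ℕ) :
    toFreeGroup (wordAt x s d) * toFreeGroup (wordAt x (s + d) e) =
      toFreeGroup (wordAt x s e) * toFreeGroup (wordAt x (s + e) d) := by
  rw [← toFreeGroup_append, ← wordAt_add, add_comm d, wordAt_add, toFreeGroup_append]

theorem hom_apply_eq_of_occ (hx : HasBasicReturns x) (hm : IsLocal x m)
    {φ : FreeGroup A →* Equiv.Perm M}
    (hφ : ∀ s (d : ℕ), Occ x w s → Occ x w (s + d) →
      φ (toFreeGroup (wordAt x s d)) (m (s + d)) = m s)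
    {s : ℤ} (hs : Occ x w s) (g : FreeGroup A) : φ g (m s) = m s := by
  obtain ⟨N, hN⟩ := hm
  -- All occurrences of the window `u` see the same state, so the return words to `u` stabilize it,
  -- and they generate the whole group.
  let u := wordAt x (s - N) (N + (N + 1) + w.length)
  let v := toFreeGroup (wordAt x (s - N) N)
  have hu (t : ℤ) (ht : Occ x u t) : Occ x w (t + N) ∧ m (t + N) = m s ∧
      toFreeGroup (wordAt x t N) = v := by
    have ht := occ_wordAt_iff.1 ht
    refine ⟨?_, hN _ _ fun k _ _ => ?_, congrArg toFreeGroup (wordAt_eq_iff.2 fun k _ _ => ?_)⟩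
    · rw [← hs, occ_wordAt_iff]
      intro k _ _
      convert ht (N + k) (by omega) (by omega) using 2 <;> ring
    · convert ht (N + k) (by omega) (by omega) using 2 <;> ring
    · exact ht k (by omega) (by omega)
  have h_fix : ∀ g, φ g (φ v (m s)) = φ v (m s) := by
    intro g
    have hg : g ∈ Subgroup.closure (toFreeGroup '' returnSet x u) := by
      rw [(hx u ⟨_, occ_wordAt x _ _⟩).closure_eq_top]
      trivial
    refine (Subgroup.closure_le
      ((MulAction.stabilizer (Equiv.Perm M) (φ v (m s))).comap φ)).2 ?_ hg
    rintro _ ⟨_, ⟨t, d, ht, rfl⟩, rfl⟩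
    obtain ⟨h_occ, h_eq, h_pre⟩ := hu t ht.occ
    obtain ⟨h_occ', h_eq', h_pre'⟩ := hu (t + d) ht.occ_add
    have h_conj := toFreeGroup_wordAt_mul x t d N
    rw [h_pre, h_pre'] at h_conj
    have h_step := hφ (t + N) d h_occ (by rwa [add_right_comm])
    rw [add_right_comm, h_eq, h_eq'] at h_step
    change φ (toFreeGroup (wordAt x t d)) (φ v (m s)) = φ v (m s)
    rw [← Equiv.Perm.mul_apply, ← map_mul, h_conj, map_mul, Equiv.Perm.mul_apply, h_step]
  simpa using h_fix (v * g * v⁻¹)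

theorem exists_isReturn_not_iff_of_ne [Finite M] (hx : HasBasicReturns x) (hm : IsLocal x m)
    {s s' : ℤ} (hs : Occ x w s) (hs' : Occ x w s') (hne : m s ≠ m s') :
    ∃ s s' d, IsReturn x w s d ∧ IsReturn x w s' d ∧ wordAt x s d = wordAt x s' d ∧
      ¬ (m (s + d) = m (s' + d) ↔ m s = m s') := by
  by_contra! h_iff
  obtain ⟨φ, hφ⟩ := exists_hom_of_isReturn (hx w ⟨s, hs⟩) h_iff
  have h_const (s : ℤ) (d : ℕ) (hs : Occ x w s) (hsd : Occ x w (s + d)) : m s = m (s + d) :=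
    (hφ s d hs hsd).symm.trans (hom_apply_eq_of_occ hx hm hφ hsd _)
  refine hne ?_
  rcases le_total s s' with hle | hle <;> obtain ⟨d, rfl⟩ := Int.le.dest hle
  · exact h_const s d hs hs'
  · exact (h_const s' d hs' hs).symm

end Monodromy

section Paths

variable {A V : Type*} {x : ℤ → A} {f : ℤ → V} {n : ℕ} {i j k : ℤ}

/-- The labelled edge crossed at time `i` by the walk that visits the vertices `f` and reads the
labels `x`: its origin, its label and its target. -/
def edgeAt (x : ℤ → A) (f : ℤ → V) (i : ℤ) : V × A × V :=
  (f i, x i, f (i + 1))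

/-- The walk follows the same path of length `n` from time `i` and from time `j`. -/
structure SamePath (x : ℤ → A) (f : ℤ → V) (n : ℕ) (i j : ℤ) : Prop where
  vertex : ∀ k : ℤ, 0 ≤ k → k ≤ n → f (i + k) = f (j + k)
  label : ∀ k : ℤ, 0 ≤ k → k < n → x (i + k) = x (j + k)

/-- The extension graph of the path of length `n` followed from time `i`, for the walk instead of
a shift space: its edges are the pairs of an edge crossed just before and an edge crossed just
after an occurrence of the path. -/
def extRel (x : ℤ → A) (f : ℤ → V) (n : ℕ) (i : ℤ) : Set ((V × A × V) × (V × A × V)) :=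
  (fun j => (edgeAt x f (j - 1), edgeAt x f (j + n))) '' {j | SamePath x f n i j}

/-- The extension graphs of all paths of length less than `g` are trees. -/
def HasTreeExtensions (x : ℤ → A) (f : ℤ → V) (g : ℕ) : Prop :=
  ∀ n < g, ∀ i, IsTreeRel (extRel x f n i)

theorem edgeAt_eq_iff : edgeAt x f i = edgeAt x f j ↔
    f i = f j ∧ x i = x j ∧ f (i + 1) = f (j + 1) := by
  simp [edgeAt]

theorem mem_extRel {u v : V × A × V} : (u, v) ∈ extRel x f n i ↔
    ∃ j, SamePath x f n i j ∧ edgeAt x f (j - 1) = u ∧ edgeAt x f (j + n) = v := by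
  simp [extRel]

theorem finite_range_edgeAt [Finite A] (x : ℤ → A) (hf : (Set.range f).Finite) :
    (Set.range (edgeAt x f)).Finite :=
  (hf.prod (Set.finite_univ.prod hf)).subset (Set.range_subset_iff.2 fun i =>
    ⟨⟨i, rfl⟩, trivial, ⟨i + 1, rfl⟩⟩)

theorem finite_extRel [Finite A] (x : ℤ → A) (hf : (Set.range f).Finite) (n : ℕ) (i : ℤ) :
    (extRel x f n i).Finite :=
  ((finite_range_edgeAt x hf).prod (finite_range_edgeAt x hf)).subset
    (Set.image_subset_iff.2 fun j _ => ⟨⟨j - 1, rfl⟩, ⟨j + n, rfl⟩⟩)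

namespace SamePath

theorem refl (x : ℤ → A) (f : ℤ → V) (n : ℕ) (i : ℤ) : SamePath x f n i i :=
  ⟨fun _ _ _ => rfl, fun _ _ _ => rfl⟩

theorem symm (h : SamePath x f n i j) : SamePath x f n j i :=
  ⟨fun l hl hln => (h.vertex l hl hln).symm, fun l hl hln => (h.label l hl hln).symm⟩

theorem trans (h : SamePath x f n i j) (h' : SamePath x f n j k) : SamePath x f n i k :=
  ⟨fun l hl hln => (h.vertex l hl hln).trans (h'.vertex l hl hln),
    fun l hl hln => (h.label l hl hln).trans (h'.label l hl hln)⟩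

theorem sub {m : ℕ} (h : SamePath x f n i j) (hk : 0 ≤ k) (hkm : k + m ≤ n) :
    SamePath x f m (i + k) (j + k) where
  vertex l _ _ := by simpa only [add_assoc] using h.vertex (k + l) (by omega) (by omega)
  label l _ _ := by simpa only [add_assoc] using h.label (k + l) (by omega) (by omega)

theorem edge (h : SamePath x f n i j) (hk : 0 ≤ k) (hkn : k < n) :
    edgeAt x f (i + k) = edgeAt x f (j + k) :=
  edgeAt_eq_iff.2 ⟨h.vertex k hk hkn.le, h.label k hk hkn, by
    simpa only [add_assoc] using h.vertex (k + 1) (by omega) (by omega)⟩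

theorem cons (h : SamePath x f n (i + 1) (j + 1)) (h_edge : edgeAt x f i = edgeAt x f j) :
    SamePath x f (n + 1) i j := by
  obtain ⟨h_vertex, h_label, -⟩ := edgeAt_eq_iff.1 h_edge
  refine ⟨fun k hk hkn => ?_, fun k hk hkn => ?_⟩ <;> rcases hk.eq_or_lt with rfl | hk
  · simpa using h_vertex
  · simpa [add_assoc] using h.vertex (k - 1) (by omega) (by omega)
  · simpa using h_label
  · simpa [add_assoc] using h.label (k - 1) (by omega) (by omega)

theorem snoc (h : SamePath x f n i j) (h_edge : edgeAt x f (i + n) = edgeAt x f (j + n)) :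
    SamePath x f (n + 1) i j := by
  obtain ⟨-, h_label, h_vertex⟩ := edgeAt_eq_iff.1 h_edge
  refine ⟨fun k hk hkn => ?_, fun k hk hkn => ?_⟩
  · rcases (show k ≤ n ∨ k = n + 1 by omega) with hkn | rfl
    · exact h.vertex k hk hkn
    · simpa only [add_assoc] using h_vertex
  · rcases (show k < n ∨ k = n by omega) with hkn | rfl
    · exact h.label k hk hkn
    · exact h_label

end SamePath

end Paths

section Reversal

variable {A V : Type*} {x : ℤ → A} {f : ℤ → V} {g n : ℕ} {i j : ℤ}

/-- The labels read by the reversed walk. The edge from time `i` to time `i + 1` becomes the edge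
from time `-1 - i` to time `-i`. -/
def reverseLabels (x : ℤ → A) (i : ℤ) : A :=
  x (-1 - i)

/-- The vertices visited by the reversed walk. -/
def reverseVertices (f : ℤ → V) (i : ℤ) : V :=
  f (-i)

/-- An edge with its origin and target exchanged. -/
def flipEdge (e : V × A × V) : V × A × V :=
  (e.2.2, e.2.1, e.1)

@[simp]
theorem reverseLabels_reverseLabels (x : ℤ → A) : reverseLabels (reverseLabels x) = x := by
  ext i
  simp [reverseLabels]

@[simp]
theorem reverseVertices_reverseVertices (f : ℤ → V) :
    reverseVertices (reverseVertices f) = f := by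
  ext i
  simp [reverseVertices]

theorem range_reverseVertices (f : ℤ → V) : Set.range (reverseVertices f) = Set.range f :=
  (Equiv.neg ℤ).surjective.range_comp f

theorem flipEdge_injective : Function.Injective (flipEdge : V × A × V → V × A × V) :=
  Function.LeftInverse.injective (g := flipEdge) fun _ => rfl

theorem edgeAt_reverse (x : ℤ → A) (f : ℤ → V) (i : ℤ) :
    edgeAt (reverseLabels x) (reverseVertices f) i = flipEdge (edgeAt x f (-1 - i)) := by
  refine Prod.ext (congrArg f ?_) (Prod.ext rfl (congrArg f ?_)) <;> ring

theorem ncard_range_edgeAt_reverse (x : ℤ → A) (f : ℤ → V) :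
    (Set.range (edgeAt (reverseLabels x) (reverseVertices f))).ncard =
      (Set.range (edgeAt x f)).ncard := by
  have h_range : Set.range (edgeAt (reverseLabels x) (reverseVertices f)) =
      flipEdge '' Set.range (edgeAt x f) := by
    rw [← Set.range_comp, ← (Equiv.subLeft (-1 : ℤ)).surjective.range_comp (flipEdge ∘ _)]
    exact congrArg Set.range (funext (edgeAt_reverse x f))
  rw [h_range, Set.ncard_image_of_injective _ flipEdge_injective]

theorem wordAt_reverse_eq (h : wordAt x i n = wordAt x j n) :
    wordAt (reverseLabels x) (-i - n) n = wordAt (reverseLabels x) (-j - n) n := by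
  rw [wordAt_eq_iff] at h ⊢
  intro k _ _
  convert h (n - 1 - k) (by omega) (by omega) using 1 <;>
  · rw [reverseLabels]; congr 1; ring

theorem SamePath.reverse (h : SamePath x f n i j) :
    SamePath (reverseLabels x) (reverseVertices f) n (-i - n) (-j - n) where
  vertex k _ _ := by
    convert h.vertex (n - k) (by omega) (by omega) using 1 <;>
    · rw [reverseVertices]; congr 1; ring
  label := wordAt_eq_iff.1 (wordAt_reverse_eq (wordAt_eq_iff.2 h.label))

theorem extRel_reverse_subset (x : ℤ → A) (f : ℤ → V) (n : ℕ) (i : ℤ) :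
    Prod.swap '' (Prod.map flipEdge flipEdge '' extRel x f n i) ⊆
      extRel (reverseLabels x) (reverseVertices f) n (-i - n) := by
  rintro _ ⟨_, ⟨_, ⟨j, hj, rfl⟩, rfl⟩, rfl⟩
  refine mem_extRel.2 ⟨-j - n, SamePath.reverse hj, ?_⟩
  rw [edgeAt_reverse, edgeAt_reverse]
  constructor <;> congr 2 <;> ring

theorem extRel_reverse (x : ℤ → A) (f : ℤ → V) (n : ℕ) (i : ℤ) :
    extRel (reverseLabels x) (reverseVertices f) n (-i - n) =
      Prod.swap '' (Prod.map flipEdge flipEdge '' extRel x f n i) := by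
  refine Set.Subset.antisymm (fun ⟨u, v⟩ huv => ?_) (extRel_reverse_subset x f n i)
  have h_sub := extRel_reverse_subset (reverseLabels x) (reverseVertices f) n (-i - n)
  rw [reverseLabels_reverseLabels, reverseVertices_reverseVertices,
    show -(-i - n) - n = i by ring] at h_sub
  exact ⟨_, ⟨_, h_sub ⟨_, ⟨_, huv, rfl⟩, rfl⟩, rfl⟩, rfl⟩

theorem HasTreeExtensions.reverse (h : HasTreeExtensions x f g) :
    HasTreeExtensions (reverseLabels x) (reverseVertices f) g := by
  intro n hn i
  rw [show i = -(-i - n) - n by ring, extRel_reverse]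
  exact ((h n hn _).prodMap_image flipEdge_injective.injOn flipEdge_injective.injOn).swap_image

end Reversal

section Folding

variable {A V : Type*} {x : ℤ → A} {f : ℤ → V} {p q q' : V} {a : A} {g n : ℕ} {i j k s s' : ℤ}

open Classical in
/-- The map that identifies the vertex `q'` with `q`. -/
noncomputable def merge (q q' : V) : V → V :=
  Function.update id q' q

/-- The action on labelled edges of the identification of `q'` with `q`. -/
noncomputable def mergeEdge (q q' : V) : V × A × V → V × A × V :=
  Prod.map (merge q q') (Prod.map id (merge q q'))

/-- A Stallings fold: from the vertex `p`, two edges with the same label `a` lead to distinct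
vertices `q` and `q'`, and they can be crossed after arbitrarily long common paths. -/
structure IsFold (x : ℤ → A) (f : ℤ → V) (p : V) (a : A) (q q' : V) : Prop where
  ne : q ≠ q'
  exists_common_past : ∀ n : ℕ, ∃ s s', SamePath x f n s s' ∧
    edgeAt x f (s + n) = (p, a, q) ∧ edgeAt x f (s' + n) = (p, a, q')

/-- A fold after which the two folded edges are the only ones to be identified, so that the
difference between the numbers of edges and of vertices is preserved. -/
structure IsRankPreservingFold (x : ℤ → A) (f : ℤ → V) (p : V) (a : A) (q q' : V) : Prop
    extends IsFold x f p a q q' where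
  edge_eq : ∀ i j, mergeEdge q q' (edgeAt x f i) = mergeEdge q q' (edgeAt x f j) →
    edgeAt x f i = edgeAt x f j ∨ (edgeAt x f i = (p, a, q) ∧ edgeAt x f j = (p, a, q')) ∨
      (edgeAt x f i = (p, a, q') ∧ edgeAt x f j = (p, a, q))

theorem merge_eq_iff {u v : V} : merge q q' u = merge q q' v ↔
    u = v ∨ (u = q ∧ v = q') ∨ (u = q' ∧ v = q) := by
  simp only [merge, Function.update_apply, id]
  grind

theorem mergeEdge_eq (p q q' : V) (a : A) :
    mergeEdge q q' (p, a, q) = mergeEdge q q' (p, a, q') := by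
  simp [mergeEdge, merge_eq_iff]

theorem SamePath.merge (h : SamePath x f n i j) (q q' : V) :
    SamePath x (merge q q' ∘ f) n i j :=
  ⟨fun k hk hkn => congrArg (ShiftSpace.merge q q') (h.vertex k hk hkn), h.label⟩

theorem fst_image_extRel_subset (x : ℤ → A) (f : ℤ → V) (n : ℕ) (i : ℤ) :
    Prod.fst '' extRel x f n i ⊆ Set.range (edgeAt x f) := by
  rintro _ ⟨_, ⟨j, -, rfl⟩, rfl⟩
  exact ⟨j - 1, rfl⟩

theorem snd_image_extRel_subset (x : ℤ → A) (f : ℤ → V) (n : ℕ) (i : ℤ) :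
    Prod.snd '' extRel x f n i ⊆ Set.range (edgeAt x f) := by
  rintro _ ⟨_, ⟨j, -, rfl⟩, rfl⟩
  exact ⟨j + n, rfl⟩

theorem target_eq_of_mem_fst_image {u : V × A × V} (hu : u ∈ Prod.fst '' extRel x f n i) :
    u.2.2 = f i := by
  obtain ⟨_, ⟨j, hj, rfl⟩, rfl⟩ := hu
  simpa [edgeAt] using (hj.vertex 0 le_rfl (by omega)).symm

theorem origin_eq_of_mem_snd_image {u : V × A × V} (hu : u ∈ Prod.snd '' extRel x f n i) :
    u.1 = f (i + n) := by
  obtain ⟨_, ⟨j, hj, rfl⟩, rfl⟩ := hu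
  exact (hj.vertex n (by omega) le_rfl).symm

theorem mem_fst_image_extRel_succ {u : V × A × V} :
    u ∈ Prod.fst '' extRel x f (n + 1) i ↔ (u, edgeAt x f (i + n)) ∈ extRel x f n i := by
  constructor
  · rintro ⟨_, ⟨j, hj, rfl⟩, rfl⟩
    exact mem_extRel.2 ⟨j, by simpa using hj.sub (m := n) le_rfl (by omega), rfl,
      (hj.edge (by omega) (by omega)).symm⟩
  · intro hu
    obtain ⟨j, hj, rfl, h_edge⟩ := mem_extRel.1 hu
    exact ⟨_, ⟨j, hj.snoc h_edge.symm, rfl⟩, rfl⟩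

theorem mem_snd_image_extRel_succ {u : V × A × V} :
    u ∈ Prod.snd '' extRel x f (n + 1) i ↔ (edgeAt x f i, u) ∈ extRel x f n (i + 1) := by
  constructor
  · rintro ⟨_, ⟨j, hj, rfl⟩, rfl⟩
    refine mem_extRel.2 ⟨j + 1, hj.sub zero_le_one (by omega), ?_, ?_⟩
    · simpa using (hj.edge le_rfl (by omega)).symm
    · simp [add_assoc, add_comm (1 : ℤ)]
  · intro hu
    obtain ⟨j, hj, h_edge, rfl⟩ := mem_extRel.1 hu
    refine ⟨_, ⟨j - 1, SamePath.cons (by simpa using hj) h_edge.symm, rfl⟩, ?_⟩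
    simp [add_assoc, add_comm]

theorem SamePath.extRel_eq (h : SamePath x f n i j) : extRel x f n j = extRel x f n i := by
  ext ⟨u, v⟩
  simp only [mem_extRel]
  exact ⟨fun ⟨k, hk, huv⟩ => ⟨k, h.trans hk, huv⟩, fun ⟨k, hk, huv⟩ => ⟨k, h.symm.trans hk, huv⟩⟩

theorem mem_extRel_of_common_past {e e' : V × A × V} (hs : SamePath x f (n + 1) s s')
    (h_edge : edgeAt x f (s + (n + 1 : ℕ)) = e) (h_edge' : edgeAt x f (s' + (n + 1 : ℕ)) = e') :
    (edgeAt x f s, e) ∈ extRel x f n (s + 1) ∧ (edgeAt x f s, e') ∈ extRel x f n (s + 1) := by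
  rw [← mem_snd_image_extRel_succ, ← mem_snd_image_extRel_succ]
  exact ⟨⟨_, ⟨s, .refl .., rfl⟩, h_edge⟩, _, ⟨s', hs, rfl⟩, h_edge'⟩

theorem image_extRel_subset (h : SamePath x (merge q q' ∘ f) n i j) :
    Prod.map (mergeEdge q q') (mergeEdge q q') '' extRel x f n j ⊆
      extRel x (merge q q' ∘ f) n i := by
  rintro _ ⟨_, ⟨k, hk, rfl⟩, rfl⟩
  exact ⟨k, h.trans (hk.merge q q'), rfl⟩

namespace IsFold

theorem samePath_common_past (H : IsFold x f p a q q') (hg : HasTreeExtensions x f g) (hn : n ≤ g)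
    (hs : SamePath x f n s s') (h_edge : edgeAt x f (s + n) = (p, a, q))
    (h_edge' : edgeAt x f (s' + n) = (p, a, q')) (he : (p, a, q) ∈ Prod.snd '' extRel x f n i)
    (he' : (p, a, q') ∈ Prod.snd '' extRel x f n i) : SamePath x f n i s := by
  induction n generalizing i s s' with
  | zero =>
    refine ⟨fun k _ _ => ?_, fun k _ _ => by omega⟩
    obtain rfl : k = 0 := by omega
    exact (origin_eq_of_mem_snd_image he).symm.trans (congrArg Prod.fst h_edge).symm
  | succ n ih =>
    have h_mem := mem_extRel_of_common_past hs h_edge h_edge'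
    rw [mem_snd_image_extRel_succ] at he he'
    rw [Nat.cast_succ, add_comm (n : ℤ), ← add_assoc] at h_edge h_edge'
    have h_common := ih (by omega) (hs.sub zero_le_one (by omega)) h_edge h_edge' ⟨_, he, rfl⟩
      ⟨_, he', rfl⟩
    rw [h_common.extRel_eq] at h_mem
    exact h_common.cons ((hg n hn (i + 1)).common_neighbor_unique (by simpa using H.ne) he he'
      h_mem.1 h_mem.2)

theorem exists_common_neighbor (H : IsFold x f p a q q') (hg : HasTreeExtensions x f g)
    (hn : n < g) (he : (p, a, q) ∈ Prod.snd '' extRel x f n i)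
    (he' : (p, a, q') ∈ Prod.snd '' extRel x f n i) :
    ∃ c, (c, (p, a, q)) ∈ extRel x f n i ∧ (c, (p, a, q')) ∈ extRel x f n i := by
  obtain ⟨s, s', hs, h_edge, h_edge'⟩ := H.exists_common_past (n + 1)
  have h_mem := mem_extRel_of_common_past hs h_edge h_edge'
  rw [Nat.cast_succ, add_comm (n : ℤ), ← add_assoc] at h_edge h_edge'
  have h_common := H.samePath_common_past hg hn.le (hs.sub zero_le_one (by omega)) h_edge h_edge'
    he he'
  exact ⟨_, h_common.extRel_eq ▸ h_mem⟩

end IsFold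

namespace IsRankPreservingFold

variable (H : IsRankPreservingFold x f p a q q')
include H

theorem vertex_eq (h : mergeEdge q q' (edgeAt x f i) = mergeEdge q q' (edgeAt x f j)) :
    f i = f j := by
  rcases H.edge_eq i j h with h | ⟨hi, hj⟩ | ⟨hi, hj⟩
  · exact congrArg Prod.fst h
  all_goals exact (congrArg Prod.fst hi).trans (congrArg Prod.fst hj).symm

theorem injOn_mergeEdge {S : Set (V × A × V)} (hS : S ⊆ Set.range (edgeAt x f))
    (h : (p, a, q) ∈ S → (p, a, q') ∉ S) : Set.InjOn (mergeEdge q q') S := by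
  intro u hu v hv huv
  obtain ⟨i, rfl⟩ := hS hu
  obtain ⟨j, rfl⟩ := hS hv
  rcases H.edge_eq i j huv with h_eq | ⟨hi, hj⟩ | ⟨hi, hj⟩
  · exact h_eq
  · exact absurd (hj ▸ hv) (h (hi ▸ hu))
  · exact absurd (hi ▸ hu) (h (hj ▸ hv))

theorem injOn_fst_image (n : ℕ) (i : ℤ) :
    Set.InjOn (mergeEdge q q') (Prod.fst '' extRel x f n i) :=
  H.injOn_mergeEdge (fst_image_extRel_subset x f n i) fun hq hq' => H.ne
    ((target_eq_of_mem_fst_image hq).trans (target_eq_of_mem_fst_image hq').symm)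

theorem samePath (h : SamePath x (merge q q' ∘ f) n i j) (h_end : f (i + n) = f (j + n)) :
    SamePath x f n i j where
  vertex k hk hkn := by
    rcases hkn.eq_or_lt with rfl | hkn
    · exact h_end
    · exact H.vertex_eq (h.edge hk hkn)
  label := h.label

theorem isTreeRel_image (hg : HasTreeExtensions x f g) (hn : n < g) (i : ℤ) :
    IsTreeRel (Prod.map (mergeEdge q q') (mergeEdge q q') '' extRel x f n i) := by
  have h_range := snd_image_extRel_subset x f n i
  by_cases h : (p, a, q) ∈ Prod.snd '' extRel x f n i ∧ (p, a, q') ∈ Prod.snd '' extRel x f n i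
  · obtain ⟨c, he, he'⟩ := H.exists_common_neighbor hg hn h.1 h.2
    refine (hg n hn i).prodMap_image_of_common_neighbor (H.injOn_fst_image n i) (c := c)
      (e' := (p, a, q')) (by simpa using H.ne) he he' (mergeEdge_eq p q q' a) ?_
    exact H.injOn_mergeEdge (Set.sdiff_subset.trans h_range) fun _ hq' => hq'.2 rfl
  · exact (hg n hn i).prodMap_image (H.injOn_fst_image n i)
      (H.injOn_mergeEdge h_range (not_and.1 h))

theorem extRel_merge_eq (h : ∀ j, SamePath x (merge q q' ∘ f) n i j → f (i + n) = f (j + n)) :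
    extRel x (merge q q' ∘ f) n i =
      Prod.map (mergeEdge q q') (mergeEdge q q') '' extRel x f n i := by
  refine Set.Subset.antisymm ?_ (image_extRel_subset (.refl ..))
  rintro _ ⟨j, hj, rfl⟩
  exact ⟨_, ⟨j, H.samePath hj (h j hj), rfl⟩, rfl⟩

theorem extRel_merge_eq_union (hi : SamePath x (merge q q' ∘ f) n k i)
    (hj : SamePath x (merge q q' ∘ f) n k j) (hiq : f (i + n) = q) (hjq : f (j + n) = q') :
    extRel x (merge q q' ∘ f) n k =
      Prod.map (mergeEdge q q') (mergeEdge q q') '' extRel x f n i ∪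
        Prod.map (mergeEdge q q') (mergeEdge q q') '' extRel x f n j := by
  refine Set.Subset.antisymm ?_ (Set.union_subset (image_extRel_subset hi)
    (image_extRel_subset hj))
  rintro _ ⟨l, hl, rfl⟩
  have h_path := hi.symm.trans hl
  have h_end : f (i + n) = f (l + n) ∨ f (j + n) = f (l + n) := by
    have := merge_eq_iff.1 (h_path.vertex n (by omega) le_rfl)
    have := H.ne
    grind
  rcases h_end with h_end | h_end
  · exact .inl ⟨_, ⟨l, H.samePath h_path h_end, rfl⟩, rfl⟩
  · exact .inr ⟨_, ⟨l, H.samePath (hj.symm.trans hl) h_end, rfl⟩, rfl⟩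

theorem disjoint_snd_image (hne : f (i + n) ≠ f (j + n)) :
    Disjoint (mergeEdge q q' '' (Prod.snd '' extRel x f n i))
      (mergeEdge q q' '' (Prod.snd '' extRel x f n j)) := by
  rw [Set.disjoint_left]
  rintro _ ⟨_, hu, rfl⟩ ⟨_, hv, huv⟩
  obtain ⟨k, rfl⟩ := snd_image_extRel_subset x f n i hu
  obtain ⟨l, rfl⟩ := snd_image_extRel_subset x f n j hv
  exact hne ((origin_eq_of_mem_snd_image hu).symm.trans
    ((H.vertex_eq huv.symm).trans (origin_eq_of_mem_snd_image hv)))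

theorem edgeAt_eq_of_target (h : mergeEdge q q' (edgeAt x f i) = mergeEdge q q' (edgeAt x f j))
    (hi : f (i + 1) = q) (hj : f (j + 1) = q') :
    edgeAt x f i = (p, a, q) ∧ edgeAt x f j = (p, a, q') := by
  rcases H.edge_eq i j h with h_eq | h_eq | ⟨h_eq, -⟩
  · exact absurd (hi.symm.trans ((edgeAt_eq_iff.1 h_eq).2.2.trans hj)) H.ne
  · exact h_eq
  · exact absurd (hi.symm.trans (congrArg (fun u => u.2.2) h_eq)) H.ne

theorem inter_fst_image_zero (hi : f i = q) (hj : f j = q') :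
    mergeEdge q q' '' (Prod.fst '' extRel x f 0 i) ∩
      mergeEdge q q' '' (Prod.fst '' extRel x f 0 j) = {mergeEdge q q' (p, a, q)} := by
  refine Set.Subset.antisymm ?_ (Set.singleton_subset_iff.2 ?_)
  · rintro _ ⟨⟨_, hu, rfl⟩, _, hv, huv⟩
    obtain ⟨k, rfl⟩ := fst_image_extRel_subset x f 0 i hu
    obtain ⟨l, rfl⟩ := fst_image_extRel_subset x f 0 j hv
    rw [(H.edgeAt_eq_of_target huv.symm ((target_eq_of_mem_fst_image hu).trans hi)
      ((target_eq_of_mem_fst_image hv).trans hj)).1]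
    rfl
  · obtain ⟨s, s', -, hs, hs'⟩ := H.exists_common_past 0
    have h_mem {t : ℤ} {r : V} (ht : edgeAt x f t = (p, a, r)) {k : ℤ} (hk : f k = r) :
        (p, a, r) ∈ Prod.fst '' extRel x f 0 k := by
      refine ⟨_, ⟨t + 1, ⟨fun l _ _ => ?_, fun l _ _ => by omega⟩, rfl⟩, by simpa using ht⟩
      obtain rfl : l = 0 := by omega
      have h_target : f (t + 1) = r := congrArg (fun u => u.2.2) ht
      simp [hk, h_target]
    exact ⟨⟨_, h_mem hs hi, rfl⟩, _, h_mem hs' hj, (mergeEdge_eq p q q' a).symm⟩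

theorem inter_fst_image_succ (hg : HasTreeExtensions x f g) (hn : n + 1 < g)
    (h : SamePath x (merge q q' ∘ f) (n + 1) i j) (hi : f (i + (n + 1 : ℕ)) = q)
    (hj : f (j + (n + 1 : ℕ)) = q') :
    ∃ c, mergeEdge q q' '' (Prod.fst '' extRel x f (n + 1) i) ∩
      mergeEdge q q' '' (Prod.fst '' extRel x f (n + 1) j) = {c} := by
  have h_edge := h.edge (k := n) (by omega) (by omega)
  have h_path : SamePath x f n i j :=
    H.samePath (by simpa using h.sub (m := n) le_rfl (by omega)) (H.vertex_eq h_edge)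
  obtain ⟨he, he'⟩ := H.edgeAt_eq_of_target h_edge (by simpa [add_assoc] using hi)
    (by simpa [add_assoc] using hj)
  have h_fst (u : V × A × V) : u ∈ Prod.fst '' extRel x f (n + 1) i ↔
      (u, (p, a, q)) ∈ extRel x f n i := by rw [mem_fst_image_extRel_succ, he]
  have h_fst' (u : V × A × V) : u ∈ Prod.fst '' extRel x f (n + 1) j ↔
      (u, (p, a, q')) ∈ extRel x f n i := by
    rw [mem_fst_image_extRel_succ, he', h_path.extRel_eq]
  obtain ⟨c, hc, hc'⟩ := H.exists_common_neighbor hg (n.lt_succ_self.trans hn)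
    ⟨_, ⟨i, .refl .., rfl⟩, he⟩ ⟨_, ⟨j, h_path, rfl⟩, he'⟩
  refine ⟨mergeEdge q q' c, Set.Subset.antisymm ?_ (Set.singleton_subset_iff.2
    ⟨⟨c, (h_fst c).2 hc, rfl⟩, c, (h_fst' c).2 hc', rfl⟩)⟩
  rintro _ ⟨⟨u, hu, rfl⟩, v, hv, huv⟩
  rw [h_fst] at hu
  rw [h_fst'] at hv
  obtain rfl := H.injOn_fst_image n i ⟨_, hv, rfl⟩ ⟨_, hu, rfl⟩ huv
  rw [(hg n (n.lt_succ_self.trans hn) i).common_neighbor_unique (by simpa using H.ne) hu hv hc hc']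
  rfl

theorem hasTreeExtensions (hg : HasTreeExtensions x f g) :
    HasTreeExtensions x (merge q q' ∘ f) g := by
  intro n hn k
  by_cases h : ∃ i j, SamePath x (merge q q' ∘ f) n k i ∧ SamePath x (merge q q' ∘ f) n k j ∧
    f (i + n) = q ∧ f (j + n) = q'
  · obtain ⟨i, j, hki, hkj, hi, hj⟩ := h
    obtain ⟨c, hc⟩ : ∃ c, mergeEdge q q' '' (Prod.fst '' extRel x f n i) ∩
        mergeEdge q q' '' (Prod.fst '' extRel x f n j) = {c} := by
      cases n with
      | zero => exact ⟨_, H.inter_fst_image_zero (by simpa using hi) (by simpa using hj)⟩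
      | succ n => exact H.inter_fst_image_succ hg hn (hki.symm.trans hkj) hi hj
    rw [H.extRel_merge_eq_union hki hkj hi hj]
    refine (H.isTreeRel_image hg hn i).union (H.isTreeRel_image hg hn j) (c := c) ?_ ?_
    · rwa [fst_image_prodMap, fst_image_prodMap]
    · rw [snd_image_prodMap, snd_image_prodMap]
      exact H.disjoint_snd_image (by rw [hi, hj]; exact H.ne)
  · rw [H.extRel_merge_eq fun j hj => ?_]
    · exact H.isTreeRel_image hg hn k
    · rcases merge_eq_iff.1 (hj.vertex n (by omega) le_rfl) with h_eq | ⟨hq, hq'⟩ | ⟨hq, hq'⟩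
      · exact h_eq
      · exact absurd ⟨k, j, .refl .., hj, hq, hq'⟩ h
      · exact absurd ⟨j, k, hj, .refl .., hq', hq⟩ h

end IsRankPreservingFold

end Folding

theorem exists_forall_of_antitone {β : Type*} {S : Set β} (hS : S.Finite) {P : ℕ → β → Prop}
    (hP : Antitone P) (h : ∀ m, ∃ s ∈ S, P m s) : ∃ s ∈ S, ∀ m, P m s := by
  by_contra! hcon
  choose! k hk using hcon
  obtain ⟨s, hs, hPs⟩ := h (hS.toFinset.sup k)
  exact hk s hs (hP (Finset.le_sup (f := k) (hS.mem_toFinset.2 hs)) _ hPs)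

section Ambiguity

variable {A V : Type*} {x : ℤ → A} {f : ℤ → V} {L n : ℕ} {s s' : ℤ}

/-- Two occurrences of a path of length `n` are followed by the same letter, but lead to distinct
vertices. -/
def HasFork (x : ℤ → A) (f : ℤ → V) (n : ℕ) : Prop :=
  ∃ i j, SamePath x f n i j ∧ x (i + n) = x (j + n) ∧ f (i + n + 1) ≠ f (j + n + 1)

theorem antitone_hasFork (x : ℤ → A) (f : ℤ → V) : Antitone (HasFork x f) := by
  rintro m n hmn ⟨i, j, h_path, h_label, h_ne⟩
  obtain ⟨k, rfl⟩ := Nat.exists_eq_add_of_le' hmn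
  have h_add (t : ℤ) : t + (k + m : ℕ) = t + k + m := by push_cast; ring
  rw [h_add, h_add] at h_label h_ne
  exact ⟨i + k, j + k, h_path.sub (by omega) (by omega), h_label, h_ne⟩

theorem hasFork_of_not_samePath (h_word : wordAt x s n = wordAt x s' n) (hL : SamePath x f L s s')
    (hn : ¬ SamePath x f n s s') : HasFork x f L := by
  induction n with
  | zero => exact absurd (by simpa using hL.sub (k := 0) (m := 0) le_rfl (by omega)) hn
  | succ n ih =>
    have h_label := wordAt_eq_iff.1 h_word
    by_cases h_path : SamePath x f n s s'
    · have h_le : L ≤ n := by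
        by_contra! h_lt
        exact hn (by simpa using hL.sub (k := 0) (m := n + 1) le_rfl (by omega))
      refine antitone_hasFork x f h_le ⟨s, s', h_path, h_label n (by omega) (by omega),
        fun h_eq => hn (h_path.snoc (edgeAt_eq_iff.2 ⟨?_, h_label n (by omega) (by omega), h_eq⟩))⟩
      exact h_path.vertex n (by omega) le_rfl
    · exact ih (wordAt_eq_iff.2 fun k hk hkn => h_label k hk (by omega)) h_path

theorem exists_return_not_iff [Finite (Set.range f)] (hx : HasBasicReturns x) (hf : IsLocal x f)
    (h_word : wordAt x s L = wordAt x s' L) (hne : ¬ SamePath x f L s s') :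
    ∃ s s' d, 0 < d ∧ wordAt x s (d + L) = wordAt x s' (d + L) ∧
      ¬ (SamePath x f L (s + d) (s' + d) ↔ SamePath x f L s s') := by
  let m (s : ℤ) (k : Fin (L + 1)) : Set.range f := ⟨f (s + (k : ℤ)), _, rfl⟩
  have hm : IsLocal x m := by
    obtain ⟨N, hN⟩ := hf
    refine ⟨N + L, fun i j h => funext fun l => Subtype.ext (hN _ _ fun k _ _ => ?_)⟩
    rw [add_assoc, add_assoc]
    exact h _ (by omega) (by omega)
  have hm_eq {i j : ℤ} (h_word : wordAt x i L = wordAt x j L) : m i = m j ↔ SamePath x f L i j := by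
    refine ⟨fun h => ⟨fun k hk hkL => ?_, wordAt_eq_iff.1 h_word⟩, fun h => funext fun k =>
      Subtype.ext (h.vertex k (by omega) (by omega))⟩
    lift k to ℕ using hk
    exact congrArg Subtype.val (congrFun h ⟨k, by omega⟩)
  obtain ⟨i, j, d, hi, hj, h_ret, h_iff⟩ := exists_isReturn_not_iff_of_ne hx hm
    (occ_wordAt x s L) (s' := s') (by rw [h_word]; exact occ_wordAt x s' L)
    fun h => hne ((hm_eq h_word).1 h)
  have h_start := (hi.occ.trans hj.occ.symm)
  have h_end := (hi.occ_add.trans hj.occ_add.symm)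
  rw [length_wordAt] at h_start h_end
  rw [hm_eq h_start, hm_eq h_end] at h_iff
  exact ⟨i, j, d, hi.pos, by rw [wordAt_add, wordAt_add, h_ret, h_end], h_iff⟩

theorem exists_not_samePath [Finite (Set.range f)] (hx : HasBasicReturns x) (hf : IsLocal x f)
    (hne : ∃ i j, f i ≠ f j) (n : ℕ) :
    ∃ L ≥ n, ∃ s s', wordAt x s L = wordAt x s' L ∧ ¬ SamePath x f L s s' := by
  induction n with
  | zero =>
    obtain ⟨i, j, hij⟩ := hne
    exact ⟨0, le_rfl, i, j, rfl, fun h => hij (by simpa using h.vertex 0 le_rfl le_rfl)⟩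
  | succ n ih =>
    obtain ⟨L, hL, s, s', h_word, h_path⟩ := ih
    obtain ⟨s, s', d, hd, h_word, h_iff⟩ := exists_return_not_iff hx hf h_word h_path
    refine ⟨d + L, by omega, s, s', h_word, fun h => h_iff (iff_of_true ?_ ?_)⟩
    · exact h.sub (by omega) (by omega)
    · simpa using h.sub (k := 0) (m := L) le_rfl (by omega)

theorem hasFork_or_hasFork_reverse [Finite (Set.range f)] (hx : HasBasicReturns x)
    (hf : IsLocal x f) (hne : ∃ i j, f i ≠ f j) (n : ℕ) :
    HasFork x f n ∨ HasFork (reverseLabels x) (reverseVertices f) n := by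
  obtain ⟨L, hL, s, s', h_word, h_path⟩ := exists_not_samePath hx hf hne n
  obtain ⟨s, s', d, -, h_word, h_iff⟩ := exists_return_not_iff hx hf h_word h_path
  by_cases h_start : SamePath x f L s s'
  · refine .inl (antitone_hasFork _ _ hL (hasFork_of_not_samePath h_word h_start fun h => h_iff ?_))
    exact iff_of_true (h.sub (by omega) (by omega)) h_start
  · have h_end : SamePath x f L (s + d) (s' + d) := by tauto
    have h_shift (t : ℤ) : -(t + d) - L = -t - (d + L : ℕ) := by push_cast; ring
    refine .inr (antitone_hasFork _ _ hL (hasFork_of_not_samePath (n := d + L)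
      (wordAt_reverse_eq h_word) (by simpa only [h_shift] using h_end.reverse) fun h => h_start ?_))
    simpa using h.reverse.sub (k := 0) (m := L) le_rfl (by omega)

theorem exists_isFold_of_hasFork [Finite A] (hf : (Set.range f).Finite)
    (h : ∀ n, HasFork x f n) : ∃ p a q q', IsFold x f p a q q' := by
  have hE := finite_range_edgeAt x hf
  let S := {u ∈ Set.range (edgeAt x f) ×ˢ Set.range (edgeAt x f) |
    u.1.1 = u.2.1 ∧ u.1.2.1 = u.2.2.1 ∧ u.1.2.2 ≠ u.2.2.2}
  let P (n : ℕ) (u : (V × A × V) × (V × A × V)) : Prop :=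
    ∃ i j, SamePath x f n i j ∧ edgeAt x f (i + n) = u.1 ∧ edgeAt x f (j + n) = u.2
  have hP : Antitone P := by
    rintro m n hmn u ⟨i, j, h_path, h_edge, h_edge'⟩
    obtain ⟨k, rfl⟩ := Nat.exists_eq_add_of_le' hmn
    rw [Nat.cast_add, ← add_assoc] at h_edge h_edge'
    exact ⟨i + k, j + k, h_path.sub (by omega) (by omega), h_edge, h_edge'⟩
  have h_ex (n : ℕ) : ∃ u ∈ S, P n u := by
    obtain ⟨i, j, h_path, h_label, h_ne⟩ := h n
    exact ⟨(edgeAt x f (i + n), edgeAt x f (j + n)), ⟨⟨⟨_, rfl⟩, _, rfl⟩,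
      h_path.vertex n (by omega) le_rfl, h_label, h_ne⟩, i, j, h_path, rfl, rfl⟩
  obtain ⟨⟨⟨p, a, q⟩, p', a', q'⟩, ⟨-, h_origin, h_label, h_ne⟩, h_past⟩ :=
    exists_forall_of_antitone ((hE.prod hE).subset (Set.sep_subset _ _)) hP h_ex
  obtain rfl : p = p' := h_origin
  obtain rfl : a = a' := h_label
  exact ⟨p, a, q, q', h_ne, h_past⟩

end Ambiguity

section Reduction

variable {A V : Type*} {x : ℤ → A} {f : ℤ → V} {q q' : V} {g : ℕ}

/-- Identifying the vertices `q` and `q'` does not increase the difference between the numbers of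
edges and of vertices and, if this difference is preserved, extension graphs remain trees. -/
structure IsReduction (x : ℤ → A) (f : ℤ → V) (q q' : V) : Prop where
  ne : q ≠ q'
  left_mem : q ∈ Set.range f
  right_mem : q' ∈ Set.range f
  card_lt : (Set.range (edgeAt x (merge q q' ∘ f))).ncard < (Set.range (edgeAt x f)).ncard
  hasTreeExtensions :
    (Set.range (edgeAt x f)).ncard ≤ (Set.range (edgeAt x (merge q q' ∘ f))).ncard + 1 →
      ∀ g, HasTreeExtensions x f g → HasTreeExtensions x (merge q q' ∘ f) g

theorem range_edgeAt_merge (x : ℤ → A) (f : ℤ → V) (q q' : V) :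
    Set.range (edgeAt x (merge q q' ∘ f)) = mergeEdge q q' '' Set.range (edgeAt x f) :=
  Set.range_comp (mergeEdge q q') (edgeAt x f)

theorem ncard_range_merge (hf : (Set.range f).Finite) (hne : q ≠ q') (hq : q ∈ Set.range f)
    (hq' : q' ∈ Set.range f) : (Set.range (merge q q' ∘ f)).ncard + 1 = (Set.range f).ncard := by
  have h_inj : Set.InjOn (merge q q') (Set.range f \ {q'}) := fun u hu v hv huv => by
    rcases merge_eq_iff.1 huv with h | ⟨-, h⟩ | ⟨h, -⟩
    exacts [h, absurd h hv.2, absurd h hu.2]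
  rw [Set.range_comp]
  exact le_antisymm (ncard_image_add_one_le_of_eq hf hq hq' hne (by simp [merge_eq_iff]))
    (ncard_le_ncard_image_add_one hf h_inj)

theorem IsLocal.comp {W : Type*} (hf : IsLocal x f) (u : V → W) : IsLocal x (u ∘ f) :=
  hf.imp fun _ h i j hij => congrArg u (h i j hij)

theorem IsReduction.reverse (H : IsReduction x f q q') :
    IsReduction (reverseLabels x) (reverseVertices f) q q' where
  ne := H.ne
  left_mem := by rw [range_reverseVertices]; exact H.left_mem
  right_mem := by rw [range_reverseVertices]; exact H.right_mem
  card_lt := by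
    rw [ncard_range_edgeAt_reverse]
    exact (ncard_range_edgeAt_reverse x _).trans_lt H.card_lt
  hasTreeExtensions h_card g hg := by
    rw [ncard_range_edgeAt_reverse] at h_card
    refine (H.hasTreeExtensions (h_card.trans_eq
      (congrArg (· + 1) (ncard_range_edgeAt_reverse x (merge q q' ∘ f)))) g ?_).reverse
    simpa using hg.reverse

theorem IsFold.isReduction [Finite A] {p : V} {a : A} (H : IsFold x f p a q q')
    (hf : (Set.range f).Finite) : IsReduction x f q q' := by
  obtain ⟨s, s', -, hs, hs'⟩ := H.exists_common_past 0
  have hE := finite_range_edgeAt x hf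
  have he : (p, a, q) ∈ Set.range (edgeAt x f) := ⟨_, hs⟩
  have he' : (p, a, q') ∈ Set.range (edgeAt x f) := ⟨_, hs'⟩
  have h_ne : (p, a, q) ≠ (p, a, q') := by simpa using H.ne
  refine ⟨H.ne, ⟨_, congrArg (fun u => u.2.2) hs⟩, ⟨_, congrArg (fun u => u.2.2) hs'⟩, ?_,
    fun h_card g hg => ?_⟩
  · rw [range_edgeAt_merge]
    exact ncard_image_add_one_le_of_eq hE he he' h_ne (mergeEdge_eq p q q' a)
  · rw [range_edgeAt_merge] at h_card
    have H' : IsRankPreservingFold x f p a q q' := ⟨H, fun i j =>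
      eq_or_of_ncard_le_ncard_image_add_one hE he he' h_ne (mergeEdge_eq p q q' a) h_card ⟨i, rfl⟩
        ⟨j, rfl⟩⟩
    exact H'.hasTreeExtensions hg

theorem exists_isReduction [Finite A] (hx : HasBasicReturns x) (hfin : (Set.range f).Finite)
    (hloc : IsLocal x f) (hne : ∃ i j, f i ≠ f j) : ∃ q q', IsReduction x f q q' := by
  have := hfin.to_subtype
  have h_fork : (∀ n, HasFork x f n) ∨
      ∀ n, HasFork (reverseLabels x) (reverseVertices f) n := by
    by_contra! ⟨⟨m, hm⟩, ⟨n, hn⟩⟩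
    rcases hasFork_or_hasFork_reverse hx hloc hne (max m n) with h | h
    · exact hm (antitone_hasFork _ _ (le_max_left m n) h)
    · exact hn (antitone_hasFork _ _ (le_max_right m n) h)
  rcases h_fork with h | h
  · obtain ⟨_, _, q, q', H⟩ := exists_isFold_of_hasFork hfin h
    exact ⟨q, q', H.isReduction hfin⟩
  · have hfin' : (Set.range (reverseVertices f)).Finite := by rwa [range_reverseVertices]
    obtain ⟨_, _, q, q', H⟩ := exists_isFold_of_hasFork hfin' h
    exact ⟨q, q', by simpa using (H.isReduction hfin').reverse⟩

theorem induction_of_isReduction [Finite A] (hx : HasBasicReturns x) {P : (ℤ → V) → Prop}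
    (const : ∀ v, P fun _ => v)
    (reduce : ∀ f q q', (Set.range f).Finite → IsLocal x f → IsReduction x f q q' →
      P (merge q q' ∘ f) → P f)
    (hfin : (Set.range f).Finite) (hloc : IsLocal x f) : P f := by
  induction hN : (Set.range f).ncard using Nat.strong_induction_on generalizing f with
  | _ N ih =>
    by_cases hne : ∃ i j, f i ≠ f j
    · obtain ⟨q, q', H⟩ := exists_isReduction hx hfin hloc hne
      have h_card := ncard_range_merge hfin H.ne H.left_mem H.right_mem
      refine reduce f q q' hfin hloc H (ih _ (by omega) ?_ (hloc.comp _) rfl)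
      rw [Set.range_comp]
      exact hfin.image _
    · push Not at hne
      rw [show f = fun _ => f 0 from funext fun i => hne i 0]
      exact const _

theorem ncard_range_add_card_le [Finite A] (hx : HasBasicReturns x)
    (hsurj : Function.Surjective x) (hfin : (Set.range f).Finite) (hloc : IsLocal x f) :
    (Set.range f).ncard + Nat.card A ≤ (Set.range (edgeAt x f)).ncard + 1 := by
  refine induction_of_isReduction (P := fun f =>
    (Set.range f).ncard + Nat.card A ≤ (Set.range (edgeAt x f)).ncard + 1) hx (fun v => ?_)
    (fun f q q' hfin _ H ih => ?_) hfin hloc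
  · have h_labels : (fun u : V × A × V => u.2.1) '' Set.range (edgeAt x fun _ => v) = Set.univ := by
      rw [← Set.range_comp]
      exact hsurj.range_eq
    have h_le := Set.ncard_image_le (f := fun u : V × A × V => u.2.1)
      (finite_range_edgeAt x (Set.finite_range_const (α := ℤ) (c := v)))
    rw [h_labels, Set.ncard_univ] at h_le
    rw [Set.range_const, Set.ncard_singleton]
    omega
  · have := ncard_range_merge hfin H.ne H.left_mem H.right_mem
    have := H.card_lt
    omega

theorem exists_hasTreeExtensions_const [Finite A] (hx : HasBasicReturns x)
    (hsurj : Function.Surjective x) (hfin : (Set.range f).Finite) (hloc : IsLocal x f)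
    (h_card : (Set.range (edgeAt x f)).ncard + 1 ≤ (Set.range f).ncard + Nat.card A)
    (hg : HasTreeExtensions x f g) : ∃ v, HasTreeExtensions x (fun _ => v : ℤ → V) g := by
  refine induction_of_isReduction (P := fun f =>
    (Set.range (edgeAt x f)).ncard + 1 ≤ (Set.range f).ncard + Nat.card A →
      HasTreeExtensions x f g → ∃ v, HasTreeExtensions x (fun _ => v : ℤ → V) g)
    hx (fun v _ hg => ⟨v, hg⟩) (fun f q q' hfin hloc H ih h_card hg => ?_) hfin hloc h_card hg
  have h_vertices := ncard_range_merge hfin H.ne H.left_mem H.right_mem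
  have h_rank := ncard_range_add_card_le hx hsurj (f := merge q q' ∘ f)
    (by rw [Set.range_comp]; exact hfin.image _) (hloc.comp _)
  have := H.card_lt
  exact ih (by omega) (H.hasTreeExtensions (by omega) g hg)

end Reduction

section SegmentGraph

variable {A : Type*} {x : ℤ → A} {w : List A} {g N d : ℕ} {i j s t : ℤ}

/-- The word read from time `i` until `g` letters after the first occurrence of `w` at or after
`i - g`. These words are the vertices visited by `x` in the graph made of a segment, labelled by
the first `g` letters of `w`, whose end is joined to its origin by one path for each return
word to `w`; the end of the segment is the empty word. -/
noncomputable def segmentVertex (x : ℤ → A) (w : List A) (g : ℕ) (i : ℤ) : List A :=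
  wordAt x i (sInf {k : ℕ | Occ x w (i - g + k)})

/-- Distinct occurrences of `w` in `x` are more than `g` apart. -/
def HasGap (x : ℤ → A) (w : List A) (g : ℕ) : Prop :=
  ∀ s d : ℤ, 0 < d → Occ x w s → Occ x w (s + d) → g < d

/-- The word `w` occurs in `x` at one of any `N + 1` consecutive positions. -/
def IsRecurrent (x : ℤ → A) (w : List A) (N : ℕ) : Prop :=
  ∀ s, ∃ k : ℕ, k ≤ N ∧ Occ x w (s + k)

theorem occ_congr (h : wordAt x s w.length = wordAt x t w.length) : Occ x w s ↔ Occ x w t := by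
  rw [Occ, Occ, h]

theorem IsRecurrent.exists_isReturn (hrec : IsRecurrent x w N) (hs : Occ x w s) :
    ∃ d, IsReturn x w s d := by
  obtain ⟨k, -, hk⟩ := hrec (s + 1)
  obtain ⟨d, hd, -⟩ := ShiftSpace.exists_isReturn (d := k + 1) hs k.succ_pos (by
    convert hk using 1; push_cast; ring)
  exact ⟨d, hd⟩

theorem segmentVertex_eq (hocc : Occ x w (i - g + d))
    (h_first : ∀ k : ℤ, 0 ≤ k → k < d → ¬ Occ x w (i - g + k)) :
    segmentVertex x w g i = wordAt x i d := by
  have h_least : IsLeast {k : ℕ | Occ x w (i - g + k)} d := by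
    refine ⟨hocc, fun k hk => ?_⟩
    by_contra! hkd
    exact h_first k (by omega) (by omega) hk
  rw [segmentVertex, h_least.csInf_eq]

theorem IsRecurrent.exists_segmentVertex_eq (hrec : IsRecurrent x w N) (g : ℕ) (i : ℤ) :
    ∃ d ≤ N, Occ x w (i - g + d) ∧ (∀ k : ℤ, 0 ≤ k → k < d → ¬ Occ x w (i - g + k)) ∧
      segmentVertex x w g i = wordAt x i d := by
  obtain ⟨k, hkN, hk⟩ := hrec (i - g)
  have h_mem : sInf {k : ℕ | Occ x w (i - g + k)} ∈ {k : ℕ | Occ x w (i - g + k)} :=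
    Nat.sInf_mem ⟨k, hk⟩
  refine ⟨_, (Nat.sInf_le hk).trans hkN, h_mem, fun l hl hl_lt hl_occ => ?_, rfl⟩
  lift l to ℕ using hl
  exact Nat.notMem_of_lt_sInf (Int.ofNat_lt.1 hl_lt) hl_occ

theorem IsRecurrent.occ_of_segmentVertex_eq_nil (hrec : IsRecurrent x w N)
    (hi : segmentVertex x w g i = []) : Occ x w (i - g) := by
  obtain ⟨d, -, hocc, -, h_eq⟩ := hrec.exists_segmentVertex_eq g i
  obtain rfl : d = 0 := by simpa [hi] using (congrArg List.length h_eq).symm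
  simpa using hocc

theorem IsRecurrent.edgeAt_segmentVertex (hrec : IsRecurrent x w N) {a : A} {u : List A}
    (hi : segmentVertex x w g i = a :: u) :
    edgeAt x (segmentVertex x w g) i = (a :: u, a, u) := by
  obtain ⟨d, -, hocc, h_first, h_eq⟩ := hrec.exists_segmentVertex_eq g i
  obtain rfl : d = 1 + u.length := by
    simpa [hi, add_comm] using (congrArg List.length h_eq).symm
  rw [hi, wordAt_add] at h_eq
  obtain ⟨h_label, h_tail⟩ : a = x i ∧ u = wordAt x (i + 1) u.length := by
    simpa [wordAt] using h_eq
  rw [edgeAt, hi, ← h_label, segmentVertex_eq (d := u.length), ← h_tail]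
  · convert hocc using 1; push_cast; ring
  · intro k _ _
    convert h_first (k + 1) (by omega) (by push_cast; omega) using 2; ring

theorem IsRecurrent.edgeAt_eq_of_ne_nil (hrec : IsRecurrent x w N)
    (hi : segmentVertex x w g i ≠ [])
    (hij : segmentVertex x w g i = segmentVertex x w g j) :
    edgeAt x (segmentVertex x w g) i = edgeAt x (segmentVertex x w g) j := by
  obtain ⟨a, u, h_eq⟩ := List.exists_cons_of_ne_nil hi
  rw [hrec.edgeAt_segmentVertex h_eq, hrec.edgeAt_segmentVertex (hij ▸ h_eq)]

theorem HasGap.segmentVertex_eq (hgap : HasGap x w g) (hs : Occ x w s) (hdg : d ≤ g) :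
    segmentVertex x w g (s + g - d) = wordAt x (s + g - d) d := by
  refine ShiftSpace.segmentVertex_eq (by convert hs using 1; ring) fun k _ hkd hk => ?_
  have := hgap _ (d - k) (by omega) hk (by convert hs using 1; ring)
  omega

theorem wordAt_eq_of_occ (hs : Occ x w s) (ht : Occ x w t) {k : ℤ} (hk : 0 ≤ k)
    (hkd : k + d ≤ w.length) : wordAt x (s + k) d = wordAt x (t + k) d := by
  have hst := wordAt_eq_iff.1 (Eq.trans hs (Eq.symm ht))
  refine wordAt_eq_iff.2 fun l _ _ => ?_
  simpa only [add_assoc] using hst (k + l) (by omega) (by omega)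

theorem HasGap.edgeAt_segment_eq (hgap : HasGap x w g) (hgw : g ≤ w.length) (hs : Occ x w s)
    (ht : Occ x w t) (hdg : d < g) :
    edgeAt x (segmentVertex x w g) (s + g - d - 1) =
      edgeAt x (segmentVertex x w g) (t + g - d - 1) := by
  have h_vertex (e : ℕ) (he : e ≤ g) :
      segmentVertex x w g (s + g - e) = segmentVertex x w g (t + g - e) := by
    rw [hgap.segmentVertex_eq hs he, hgap.segmentVertex_eq ht he, add_sub_assoc, add_sub_assoc]
    exact wordAt_eq_of_occ hs ht (by omega) (by omega)
  have h_label := wordAt_eq_iff.1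
    (wordAt_eq_of_occ (d := 1) hs ht (k := g - d - 1) (by omega) (by push_cast; omega))
    0 le_rfl (by simp)
  rw [edgeAt_eq_iff]
  refine ⟨?_, ?_, by simpa using h_vertex d hdg.le⟩
  · convert h_vertex (d + 1) (by omega) using 2 <;> push_cast <;> ring
  · convert h_label using 2 <;> ring

theorem IsReturn.segmentVertex_eq (hs : IsReturn x w s d) :
    segmentVertex x w g (s + g + 1) = wordAt x (s + g + 1) (d - 1) := by
  have := hs.pos
  refine ShiftSpace.segmentVertex_eq ?_ fun k _ _ => ?_
  · convert hs.occ_add using 1; push_cast [this]; ring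
  · convert hs.not_occ (k + 1) (by omega) (by omega) using 2; ring

theorem HasGap.edgeAt_eq_of_isReturn (hgap : HasGap x w g) (hgw : g ≤ w.length)
    (hs : IsReturn x w s d) (ht : IsReturn x w t d) (hst : wordAt x s d = wordAt x t d) :
    edgeAt x (segmentVertex x w g) (s + g) = edgeAt x (segmentVertex x w g) (t + g) := by
  have hgd : (g : ℤ) < d := hgap s d (by have := hs.pos; omega) hs.occ hs.occ_add
  have h_long : ∀ k : ℤ, 0 ≤ k → k < (d + g : ℕ) → x (s + k) = x (t + k) := by
    refine wordAt_eq_iff.1 ?_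
    have := wordAt_eq_of_occ (d := g) hs.occ_add ht.occ_add le_rfl (by omega)
    rw [wordAt_add, wordAt_add, hst]
    simpa using this
  have h_end {r : ℤ} (hr : IsReturn x w r d) : segmentVertex x w g (r + g) = [] := by
    simpa [wordAt] using hgap.segmentVertex_eq hr.occ (Nat.zero_le g)
  rw [edgeAt_eq_iff, h_end hs, h_end ht, hs.segmentVertex_eq, ht.segmentVertex_eq]
  refine ⟨rfl, h_long g (by omega) (by push_cast; omega), wordAt_eq_iff.2 fun k _ _ => ?_⟩
  simpa only [add_assoc] using h_long (g + (1 + k)) (by omega) (by push_cast; omega)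

theorem IsRecurrent.finite_range_segmentVertex [Finite A] (hrec : IsRecurrent x w N) (g : ℕ) :
    (Set.range (segmentVertex x w g)).Finite := by
  refine (List.finite_length_le A N).subset (Set.range_subset_iff.2 fun i => ?_)
  obtain ⟨d, hdN, -, -, h_eq⟩ := hrec.exists_segmentVertex_eq g i
  simpa [h_eq] using hdN

theorem IsRecurrent.isLocal_segmentVertex (hrec : IsRecurrent x w N) (g : ℕ) :
    IsLocal x (segmentVertex x w g) := by
  refine ⟨g + N + w.length, fun i j hij => ?_⟩
  obtain ⟨d, hdN, hocc, h_first, h_eq⟩ := hrec.exists_segmentVertex_eq g i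
  have h_occ_iff (k : ℤ) (_ : 0 ≤ k) (_ : k ≤ d) : Occ x w (i - g + k) ↔ Occ x w (j - g + k) := by
    refine occ_congr (wordAt_eq_iff.2 fun l _ _ => ?_)
    convert hij (-g + k + l) (by push_cast; omega) (by push_cast; omega) using 2 <;> ring
  rw [h_eq, segmentVertex_eq (d := d) ((h_occ_iff d (by omega) le_rfl).1 hocc) fun k hk hkd =>
    mt (h_occ_iff k hk hkd.le).2 (h_first k hk hkd)]
  exact wordAt_eq_iff.2 fun k _ _ => hij k (by push_cast; omega) (by push_cast; omega)

theorem ncard_edges_from_nil_le (hgap : HasGap x w g) (hgw : g ≤ w.length)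
    (hrec : IsRecurrent x w N) (hret : (returnSet x w).Finite) :
    {e ∈ Set.range (edgeAt x (segmentVertex x w g)) | e.1 = []}.ncard ≤
      (returnSet x w).ncard := by
  choose! s d hs using fun r (hr : r ∈ returnSet x w) => hr
  refine (Set.ncard_le_ncard (t := (fun r => edgeAt x (segmentVertex x w g) (s r + g)) ''
    returnSet x w) ?_ (hret.image _)).trans (Set.ncard_image_le hret)
  rintro _ ⟨⟨i, rfl⟩, hi⟩
  obtain ⟨e, he⟩ := hrec.exists_isReturn (hrec.occ_of_segmentVertex_eq_nil hi)
  have h_mem : wordAt x (i - g) e ∈ returnSet x w := ⟨_, _, he, rfl⟩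
  obtain ⟨h_return, h_word⟩ := hs _ h_mem
  have h_length : d (wordAt x (i - g) e) = e := by simpa using congrArg List.length h_word
  rw [h_length] at h_return h_word
  exact ⟨_, h_mem, by simpa using hgap.edgeAt_eq_of_isReturn hgw h_return he h_word⟩

theorem ncard_range_edgeAt_segmentVertex_add_one_le [Finite A] (hgap : HasGap x w g)
    (hgw : g ≤ w.length) (hrec : IsRecurrent x w N) (hret : (returnSet x w).Finite) :
    (Set.range (edgeAt x (segmentVertex x w g))).ncard + 1 ≤
      (Set.range (segmentVertex x w g)).ncard + (returnSet x w).ncard := by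
  let f := segmentVertex x w g
  have hfin : (Set.range f).Finite := hrec.finite_range_segmentVertex g
  have h_nil : [] ∈ Set.range f := by
    obtain ⟨k, -, hk⟩ := hrec 0
    exact ⟨0 + k + g, by simpa [wordAt] using hgap.segmentVertex_eq hk (Nat.zero_le g)⟩
  have h_others : {e ∈ Set.range (edgeAt x f) | e.1 ≠ []}.ncard ≤
      (Set.range f \ {[]}).ncard := by
    refine Set.ncard_le_ncard_of_injOn Prod.fst ?_ ?_ hfin.sdiff
    · rintro _ ⟨⟨i, rfl⟩, hi⟩
      exact ⟨⟨i, rfl⟩, hi⟩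
    · rintro _ ⟨⟨i, rfl⟩, hi⟩ _ ⟨⟨j, rfl⟩, -⟩ hij
      exact hrec.edgeAt_eq_of_ne_nil hi hij
  have h_split : {e ∈ Set.range (edgeAt x f) | e.1 = []}.ncard +
      {e ∈ Set.range (edgeAt x f) | e.1 ≠ []}.ncard = (Set.range (edgeAt x f)).ncard :=
    Set.ncard_inter_add_ncard_sdiff_eq_ncard _ {e : List A × A × List A | e.1 = []}
      (finite_range_edgeAt x hfin)
  have h_sdiff := Set.ncard_sdiff_singleton_add_one h_nil hfin
  have h_from_nil : {e ∈ Set.range (edgeAt x f) | e.1 = []}.ncard ≤ (returnSet x w).ncard :=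
    ncard_edges_from_nil_le hgap hgw hrec hret
  change (Set.range (edgeAt x f)).ncard + 1 ≤ (Set.range f).ncard + _
  omega

theorem hasTreeExtensions_segmentVertex [Finite A] (hgap : HasGap x w g) (hgw : g ≤ w.length)
    (hrec : IsRecurrent x w N) : HasTreeExtensions x (segmentVertex x w g) g := by
  intro n hn i
  let f := segmentVertex x w g
  have hfin := finite_extRel x (hrec.finite_range_segmentVertex g) n i
  have hne : (extRel x f n i).Nonempty := ⟨_, i, SamePath.refl x f n i, rfl⟩
  have h_end (j : ℤ) (hj : SamePath x f n i j) : f (i + n) = f (j + n) :=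
    hj.vertex n (by omega) le_rfl
  by_cases h_nil : f (i + n) = []
  · refine IsTreeRel.of_fst_eq hfin hne ?_
    rintro _ ⟨j, hj, rfl⟩ _ ⟨k, hk, rfl⟩
    convert hgap.edgeAt_segment_eq hgw
      (hrec.occ_of_segmentVertex_eq_nil ((h_end j hj).symm.trans h_nil))
      (hrec.occ_of_segmentVertex_eq_nil ((h_end k hk).symm.trans h_nil)) hn using 2 <;> ring
  · refine IsTreeRel.of_snd_eq hfin hne ?_
    rintro _ ⟨j, hj, rfl⟩ _ ⟨k, hk, rfl⟩
    exact hrec.edgeAt_eq_of_ne_nil (fun h => h_nil ((h_end j hj).trans h))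
      ((h_end j hj).symm.trans (h_end k hk))

end SegmentGraph

section LetterExtensions

variable {A : Type*} {x : ℤ → A} {w : List A}

theorem exists_hasGap_or_periodic (x : ℤ → A) (g : ℕ) :
    (∃ w s, g ≤ w.length ∧ Occ x w s ∧ HasGap x w g) ∨ ∃ d : ℕ, 0 < d ∧ Function.Periodic x d := by
  refine or_iff_not_imp_left.2 fun h_gap => ?_
  push Not at h_gap
  let P (m d : ℕ) : Prop := ∀ i : ℤ, -m ≤ i → i ≤ m → x (i + d) = x i
  have hP : Antitone P := fun m n hmn d hd i _ _ => hd i (by omega) (by omega)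
  have h_ex (m : ℕ) : ∃ d ∈ {d : ℕ | 0 < d ∧ d ≤ g}, P m d := by
    have h_window := h_gap (wordAt x (-m) (2 * m + 1 + g)) (-m) (by simp) (occ_wordAt x _ _)
    simp only [HasGap, not_forall, not_lt] at h_window
    obtain ⟨s, d, hd, hs, hsd, hdg⟩ := h_window
    lift d to ℕ using hd.le
    rw [occ_wordAt_iff] at hs hsd
    refine ⟨d, ⟨by omega, by omega⟩, fun i _ _ => ?_⟩
    have h_left := hs (i + m + d) (by omega) (by push_cast; omega)
    have h_right := hsd (i + m) (by omega) (by push_cast; omega)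
    calc x (i + d) = x (s + (i + m + d)) := by rw [h_left]; congr 1; ring
      _ = x (s + d + (i + m)) := by congr 1; ring
      _ = x i := by rw [h_right]; congr 1; ring
  obtain ⟨d, ⟨hd, -⟩, h_per⟩ := exists_forall_of_antitone
    ((Set.finite_le_nat g).subset fun d hd => hd.2) hP h_ex
  exact ⟨d, hd, fun i => h_per i.natAbs i (by omega) (by omega)⟩

theorem returnSet_subsingleton (h : ∀ s t k, Occ x w s → Occ x w t → x (s + k) = x (t + k)) :
    (returnSet x w).Subsingleton := by
  have h_le {s t : ℤ} {d e : ℕ} (hs : IsReturn x w s d) (ht : IsReturn x w t e) : d ≤ e := by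
    by_contra! hed
    refine hs.not_occ e (by have := ht.pos; omega) (by omega) ((occ_congr ?_).1 ht.occ_add)
    exact wordAt_eq_iff.2 fun k _ _ => by simpa only [add_assoc] using h t s (e + k) ht.occ hs.occ
  rintro _ ⟨s, d, hs, rfl⟩ _ ⟨t, e, ht, rfl⟩
  obtain rfl := (h_le hs ht).antisymm (h_le ht hs)
  exact wordAt_eq_iff.2 fun k _ _ => h s t k hs.occ ht.occ

theorem eq_of_occ_of_periodic {d : ℕ} (hd : 0 < d) (hx : Function.Periodic x d) {s t : ℤ}
    (h : wordAt x s d = wordAt x t d) (k : ℤ) : x (s + k) = x (t + k) := by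
  have h_per (r : ℤ) : x (r + k) = x (r + k % d) := by
    conv_lhs => rw [← Int.emod_add_mul_ediv k d, mul_comm, ← add_assoc]
    simpa using hx.int_mul (k / d) (r + k % d)
  rw [h_per s, h_per t]
  exact wordAt_eq_iff.1 h _ (Int.emod_nonneg _ (by omega)) (Int.emod_lt_of_pos _ (by omega))

theorem surjective_of_closure_returnSet_eq_top
    (hw : Subgroup.closure (toFreeGroup '' returnSet x w) = ⊤) : Function.Surjective x := by
  classical
  intro a
  by_contra! ha
  let ψ : FreeGroup A →* Multiplicative ℤ :=
    FreeGroup.lift fun b => if b = a then Multiplicative.ofAdd 1 else 1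
  have h_ker : FreeGroup.of a ∈ ψ.ker := by
    refine (Subgroup.closure_le ψ.ker).2 ?_ (hw ▸ Subgroup.mem_top _)
    rintro _ ⟨_, ⟨s, d, -, rfl⟩, rfl⟩
    refine Subgroup.list_prod_mem _ fun u hu => ?_
    obtain ⟨b, hb, rfl⟩ := List.mem_map.1 hu
    obtain ⟨k, rfl⟩ := (List.mem_ofFn' _ _).1 hb
    simp [ψ, MonoidHom.mem_ker, ha]
  simp [ψ, MonoidHom.mem_ker] at h_ker

theorem HasBasicReturns.ncard_returnSet (hx : HasBasicReturns x) {s : ℤ} (hs : Occ x w s) :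
    (returnSet x w).ncard = Nat.card A := by
  rw [← (hx w ⟨s, hs⟩).card_eq, Nat.card_coe_set_eq,
    Set.ncard_image_of_injective _ toFreeGroup_injective]

theorem HasBasicReturns.subsingleton_of_periodic [Finite A] (hx : HasBasicReturns x) {d : ℕ}
    (hd : 0 < d) (h_per : Function.Periodic x d) : Subsingleton A := by
  have h_ret : (returnSet x (wordAt x 0 d)).Subsingleton :=
    returnSet_subsingleton fun s t k hs ht => eq_of_occ_of_periodic hd h_per
      (wordAt_eq_iff.2 fun l hl hld => (occ_wordAt_iff.1 hs l hl hld).trans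
        (occ_wordAt_iff.1 ht l hl hld).symm) k
  have := h_ret.finite.to_subtype
  have h_card := Set.ncard_le_one_iff_subsingleton.2 h_ret
  rw [hx.ncard_returnSet (occ_wordAt x 0 d)] at h_card
  exact Finite.card_le_one_iff_subsingleton.1 h_card

theorem edgeAt_const_eq {V : Type*} {v : V} {i j : ℤ} (h : x i = x j) :
    edgeAt x (fun _ => v) i = edgeAt x (fun _ => v) j :=
  edgeAt_eq_iff.2 ⟨rfl, h, rfl⟩

theorem HasBasicReturns.exists_hasTreeExtensions [Finite A] (hx : HasBasicReturns x)
    (hrec : ∀ w s, Occ x w s → ∃ N, IsRecurrent x w N) (g : ℕ) :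
    ∃ v : List A, HasTreeExtensions x (fun _ => v) g := by
  rcases exists_hasGap_or_periodic x g with ⟨w, s, hgw, hs, hgap⟩ | ⟨d, hd, h_per⟩
  · obtain ⟨N, hN⟩ := hrec w s hs
    have h_card : 0 < Nat.card A := Nat.card_pos_iff.2 ⟨⟨x 0⟩, inferInstance⟩
    have h_le := ncard_range_edgeAt_segmentVertex_add_one_le hgap hgw hN
      (Set.finite_of_ncard_pos (hx.ncard_returnSet hs ▸ h_card))
    rw [hx.ncard_returnSet hs] at h_le
    exact exists_hasTreeExtensions_const hx
      (surjective_of_closure_returnSet_eq_top (hx w ⟨s, hs⟩).closure_eq_top)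
      (hN.finite_range_segmentVertex g) (hN.isLocal_segmentVertex g) h_le
      (hasTreeExtensions_segmentVertex hgap hgw hN)
  · have := hx.subsingleton_of_periodic hd h_per
    refine ⟨[], fun n _ i => IsTreeRel.of_fst_eq (finite_extRel x Set.finite_range_const n i)
      ⟨_, i, SamePath.refl x _ n i, rfl⟩ ?_⟩
    rintro _ ⟨j, -, rfl⟩ _ ⟨k, -, rfl⟩
    exact edgeAt_const_eq (Subsingleton.elim _ _)

theorem samePath_const_iff {V : Type*} {v : V} {s t : ℤ} (hs : Occ x w s) :
    SamePath x (fun _ => v) w.length s t ↔ Occ x w t := by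
  refine ⟨fun h => (wordAt_eq_iff.2 h.label).symm.trans hs, fun ht => ⟨fun _ _ _ => rfl, ?_⟩⟩
  exact wordAt_eq_iff.1 (Eq.trans hs (Eq.symm ht))

theorem HasBasicReturns.isTreeRel [Finite A] (hx : HasBasicReturns x)
    (hrec : ∀ w s, Occ x w s → ∃ N, IsRecurrent x w N) {s : ℤ} (hs : Occ x w s) :
    IsTreeRel {p : A × A | ∃ s, Occ x (p.1 :: (w ++ [p.2])) s} := by
  obtain ⟨v, hv⟩ := hx.exists_hasTreeExtensions hrec (w.length + 1)
  have h_image : Prod.map (fun e : List A × A × List A => e.2.1) (fun e => e.2.1) ''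
      extRel x (fun _ => v) w.length s = {p : A × A | ∃ s, Occ x (p.1 :: (w ++ [p.2])) s} := by
    ext ⟨a, b⟩
    simp only [extRel, Set.image_image, Prod.map_apply, edgeAt, Set.mem_image, Set.mem_ofPred_eq,
      Prod.mk.injEq, occ_cons_iff, occ_append_singleton_iff, samePath_const_iff hs]
    exact ⟨fun ⟨j, hj, ha, hb⟩ => ⟨j - 1, ha, by simpa using hj, by simpa using hb⟩,
      fun ⟨j, ha, hj, hb⟩ => ⟨j + 1, hj, by simpa using ha, hb⟩⟩
  rw [← h_image]
  refine (hv w.length (Nat.lt_succ_self _) s).prodMap_image ?_ ?_ <;>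
  · rintro _ ⟨_, ⟨j, -, rfl⟩, rfl⟩ _ ⟨_, ⟨k, -, rfl⟩, rfl⟩ h
    exact edgeAt_const_eq h

end LetterExtensions

section Minimality

variable {A : Type*} [TopologicalSpace A] {X : Subshift A ℤ} {x y : ℤ → A} {w : List A}

/-- The closure of the orbit of `y`. -/
def orbitClosure (y : ℤ → A) : Subshift A ℤ where
  carrier := closure (Set.range fun g : ℤ => shift g y)
  isClosed := isClosed_closure
  mapsTo g _ hz := by
    refine map_mem_closure (continuous_shift g) hz ?_
    rintro _ ⟨h, rfl⟩
    exact ⟨h + g, shift_add h g y⟩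

theorem IsMinimal.mem_closure_orbit (hX : IsMinimal X) (hx : x ∈ X.carrier) (hy : y ∈ X.carrier) :
    y ∈ closure (Set.range fun g : ℤ => shift g x) := by
  have h_eq : (orbitClosure x).carrier = X.carrier := hX.2 (orbitClosure x)
    ⟨_, subset_closure ⟨0, rfl⟩⟩
    (closure_minimal (Set.range_subset_iff.2 fun g => X.mapsTo g hx) X.isClosed)
  exact h_eq.ge hy

theorem mem_language : w ∈ language X ↔ ∃ x ∈ X.carrier, ∃ s, Occ x w s := by
  constructor
  · rintro ⟨x, hx, s, n, rfl⟩
    exact ⟨x, hx, s, occ_wordAt x s n⟩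
  · rintro ⟨x, hx, s, hs⟩
    exact ⟨x, hx, s, _, hs.symm⟩

theorem isOpen_setOf_occ [DiscreteTopology A] (w : List A) (s : ℤ) :
    IsOpen {y : ℤ → A | Occ y w s} := by
  refine isOpen_iff_forall_mem_open.2 fun y hy => ⟨cylinder (Finset.Ico s (s + w.length)) y,
    fun z hz => ?_, isOpen_cylinder _ _, fun _ _ => rfl⟩
  exact Eq.trans (wordAt_eq_iff.2 fun k _ _ => hz _ (Finset.mem_Ico.2 (by omega))) hy

variable [DiscreteTopology A]

theorem IsMinimal.mem_language_iff (hX : IsMinimal X) (hx : x ∈ X.carrier) :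
    w ∈ language X ↔ ∃ s, Occ x w s := by
  refine mem_language.trans ⟨?_, fun ⟨s, hs⟩ => ⟨x, hx, s, hs⟩⟩
  rintro ⟨y, hy, s, hs⟩
  obtain ⟨_, h_occ, g, rfl⟩ :=
    mem_closure_iff.1 (hX.mem_closure_orbit hx hy) _ (isOpen_setOf_occ w s) hs
  exact ⟨g + s, occ_shift_iff.1 h_occ⟩

theorem IsMinimal.exists_isRecurrent [Finite A] (hX : IsMinimal X) (hx : x ∈ X.carrier) {s : ℤ}
    (hs : Occ x w s) : ∃ N, IsRecurrent x w N := by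
  obtain ⟨F, hF⟩ := X.isClosed.isCompact.elim_finite_subcover _ (isOpen_setOf_occ w)
    fun y hy => Set.mem_iUnion.2 ((hX.mem_language_iff hy).1 (mem_language.2 ⟨x, hx, s, hs⟩))
  refine ⟨2 * F.sup Int.natAbs, fun t => ?_⟩
  obtain ⟨i, hi, h_occ⟩ := Set.mem_iUnion₂.1 (hF (X.mapsTo (t + F.sup Int.natAbs) hx))
  have hi_le : i.natAbs ≤ F.sup Int.natAbs := Finset.le_sup hi
  refine ⟨(F.sup Int.natAbs + i).toNat, by omega, ?_⟩
  convert occ_shift_iff.1 h_occ using 1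
  omega

theorem IsMinimal.returnWords_eq (hX : IsMinimal X) (hx : x ∈ X.carrier) (w : List A) :
    returnWords X w = returnSet x w := by
  ext r
  constructor
  · rintro ⟨h_ne, h_mem, h_prefix, h_inner⟩
    obtain ⟨s, hs⟩ := (hX.mem_language_iff hx).1 h_mem
    exact ⟨s, r.length, (isReturn_length_iff hs).2 ⟨h_ne, h_prefix, h_inner⟩,
      (occ_append_iff.1 hs).1⟩
  · rintro ⟨s, d, hs, rfl⟩
    have h_occ : Occ x (wordAt x s d ++ w) s :=
      occ_append_iff.2 ⟨occ_wordAt x s d, by simpa using hs.occ_add⟩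
    obtain ⟨h_ne, h_prefix, h_inner⟩ := (isReturn_length_iff h_occ).1 (by simpa using hs)
    exact ⟨h_ne, (hX.mem_language_iff hx).2 ⟨s, h_occ⟩, h_prefix, h_inner⟩

theorem IsMinimal.fst_image_biExt (hX : IsMinimal X) (w : List A) :
    Prod.fst '' biExt X w = leftExt X w := by
  obtain ⟨x, hx⟩ := hX.1
  ext a
  simp only [biExt, leftExt, Set.mem_image, Set.mem_ofPred_eq, hX.mem_language_iff hx, Prod.exists,
    exists_and_right, exists_eq_right, occ_cons_iff, occ_append_singleton_iff]
  exact ⟨fun ⟨_, s, ha, hs, _⟩ => ⟨s, ha, hs⟩, fun ⟨s, ha, hs⟩ => ⟨_, s, ha, hs, rfl⟩⟩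

theorem IsMinimal.snd_image_biExt (hX : IsMinimal X) (w : List A) :
    Prod.snd '' biExt X w = rightExt X w := by
  obtain ⟨x, hx⟩ := hX.1
  ext b
  simp only [biExt, rightExt, Set.mem_image, Set.mem_ofPred_eq, hX.mem_language_iff hx, Prod.exists,
    exists_eq_right, occ_cons_iff, occ_append_singleton_iff]
  exact ⟨fun ⟨_, s, _, hs, hb⟩ => ⟨s + 1, hs, hb⟩,
    fun ⟨s, hs, hb⟩ => ⟨_, s - 1, rfl, by simpa using hs, by simpa using hb⟩⟩

end Minimality

end ShiftSpace

theorem theorem2 {A : Type*} [Finite A] [TopologicalSpace A] [DiscreteTopology A]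
    (X : Subshift A ℤ) (hX : ShiftSpace.IsMinimal X)
    (hbasis : ∀ w ∈ ShiftSpace.language X,
      ShiftSpace.IsBasis (ShiftSpace.toFreeGroup '' ShiftSpace.returnWords X w)) :
    ShiftSpace.IsDendric X := by
  intro w hw
  obtain ⟨x, hx⟩ := hX.1
  have h_basic : ShiftSpace.HasBasicReturns x := fun v hv => by
    rw [← hX.returnWords_eq hx]
    exact hbasis v ((hX.mem_language_iff hx).2 hv)
  obtain ⟨s, hs⟩ := (hX.mem_language_iff hx).1 hw
  have h_tree : ShiftSpace.IsTreeRel (ShiftSpace.biExt X w) := by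
    simpa only [ShiftSpace.biExt, hX.mem_language_iff hx] using
      h_basic.isTreeRel (fun _ _ => hX.exists_isRecurrent hx) hs
  exact h_tree.isTree (hX.fst_image_biExt w) (hX.snd_image_biExt w)
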